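/- Let $X$ be a first-countable compact Hausdorff space and let $\gamma=(\gamma_1,\dots,\gamma_N)$ be a finite family of continuous maps $X\to X$, all of which are embeddings. For a set $T$ put $\gamma(T)=\bigcup_k\gamma_k(T)$, and for a finite index sequence $\boldsymbol k=(k_n,\dots,k_1)$ put $\gamma_{\boldsymbol k}=\gamma_{k_n}\circ\cdots\circ\gamma_{k_1}$. Let $U\subseteq X$ be a dense open set such that $\gamma_1(U),\dots,\gamma_N(U)$ are pairwise disjoint, open, and contained in $U$. Let $\mathcal X\subseteq U$ be a subset that is dense and comeager in $X$ and satisfies $\gamma_k(\mathcal X)\subseteq\mathcal X$ and $\gamma_k^{-1}(\mathcal X)\subseteq\mathcal X$ for all $k$, such that the images $\gamma_1(\mathcal X),\dots,\gamma_N(\mathcal X)$ are pairwise disjoint and every $\gamma_k|_{\mathcal X}$ is injective. Let $M_{\mathcal X}=B(\ell^2(\mathcal X))$, with standard basis $(e_x)_{x\in\mathcal X}$ of $\ell^2(\mathcal X)$ and entries $\langle e_x,\alpha e_y\rangle$. Call $\alpha\in M_{\mathcal X}$ diagonal if all its off-diagonal entries vanish, and quasi-monomial if each row and each column has at most one non-zero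 entry. Let $G=\{(\gamma_k(y),y): y\in X,\ 1\le k\le N\}$. For $a\in C(X)$ and $f\in C(G)$ define $\rho_A(a),\rho_E(f)\in M_{\mathcal X}$ by $$\rho_A(a)e_x=a(x)e_x,\qquad \rho_E(f)e_y=\sum_{k=1}^N f(\gamma_k(y),y)\,e_{\gamma_k(y)} .$$ Let $\upsilon_n$ be the shift $e_k\mapsto e_{n+k}$ on $\ell^2(\mathbb Z)$. Let $C^*(\rho)\subseteq M_{\mathcal X}$ be the C*-algebra generated by all $\rho_A(a)$ and $\rho_E(f)$, and let $C^*(\hat\rho)\subseteq M_{\mathcal X}\otimes C^*(\mathbb Z)$ be the C*-algebra generated by all $\rho_A(a)\otimes\upsilon_0$ and $\rho_E(f)\otimes\upsilon_1$. For $m,n\ge 0$ let $X_{m,n}$ be the compact space of pairs $((x_m,\dots,x_0),(y_n,\dots,y_0))$ of sequences in $X$ with $x_0=y_0$ in which each $x_{i+1}$ equals $\gamma_k(x_i)$ for some $k$, and each $y_{i+1}$ equals $\gamma_k(y_i)$ for some $k$. For an index sequence $\boldsymbol k=(k_n,\dots,k_1)$ and $x\in X$ write $\boldsymbol\gamma_{\boldsymbol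 k}(x)=(\gamma_{k_n}\cdots\gamma_{k_1}(x),\dots,\gamma_{k_1}(x),x)$. For $f\in C(X_{m,n})$ let $\rho_{m,n}(f)\in M_{\mathcal X}$ be the operator that sends $e_y$ to $\sum_{\boldsymbol j\in\{1,\dots,N\}^m}f(\boldsymbol\gamma_{\boldsymbol j}(x),\boldsymbol\gamma_{\boldsymbol k}(x))\,e_{\gamma_{\boldsymbol j}(x)}$ if $y=\gamma_{\boldsymbol k}(x)$ with $x\in\mathcal X$ and $\boldsymbol k$ of length $n$ (these are then unique), and to $0$ if $y\notin\gamma^n(\mathcal X)$. For $k\in\mathbb Z$ let $B_k$ be the closed linear span of the ranges of all $\rho_{m,n}$ with $m-n=k$, let $D_k$ be the set of diagonal matrices in $B_k$, and let $\hat D=\bigoplus_{k\in\mathbb Z}D_k\otimes\upsilon_k$ (the closed linear span). For a C*-subalgebra $A$ of a C*-algebra $B$ let $N(A,B)=\{b\in B: bAb^*\subseteq A,\ b^*Ab\subseteq A\}$; $A$ is called regular in $B$ if $N(A,B)$ generates $B$ as a C*-algebra. Assume in addition that: * $\gamma$ is essentially free: for any two distinct finite index sequences $\boldsymbol k\ne\boldsymbol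 l$ (of possibly different lengths) the set $\{x\in X:\gamma_{\boldsymbol k}(x)=\gamma_{\boldsymbol l}(x)\}$ is nowhere dense; * $\gamma^n(X)$ is clopen in $X$ for all $n$; * there is a continuous map $\sigma\colon\gamma(X)\to X$ with $\sigma\circ\gamma_k=\mathrm{id}_X$ for all $k$. Then $D_0$ is a C*-subalgebra of $C^*(\rho)$, $\hat D$ is a C*-subalgebra of $C^*(\hat\rho)$, and the following are equivalent: 1. $\gamma$ satisfies the graph separation condition: $\gamma_j(x)\ne\gamma_k(x)$ for all distinct indices $j,k$ and all $x\in X$; 2. $D_0$ is regular in $C^*(\rho)$; 3. $\hat D$ is regular in $C^*(\hat\rho)$. Moreover, $N(D_0,C^*(\rho))$ is exactly the set of quasi-monomial matrices in $C^*(\rho)$. -/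

import Mathlib

open Set Topology
open scoped ENNReal lp

noncomputable section

set_option linter.unusedSectionVars false

namespace KW

/-! ### Operators on `ℓ²`-spaces -/

/-- The Hilbert space `ℓ²(S)` (the Hilbert direct sum of `S` copies of `ℂ`). -/
abbrev L2 (S : Type*) := lp (fun _ : S => ℂ) 2

/-- The C*-algebra of all bounded operators on `ℓ²(S)`; its elements are the
`S`-squared matrices. -/
abbrev Mat (S : Type*) := L2 S →L[ℂ] L2 S

/-- The Hilbert space `ℓ²(S) ⊗ ℓ²(ℤ)`, realised as `ℓ²(ℤ, ℓ²(S))`. -/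
abbrev L2Z (S : Type*) := lp (fun _ : ℤ => L2 S) 2

/-- Bounded operators on `ℓ²(S) ⊗ ℓ²(ℤ)`. This C*-algebra contains the spatial tensor product of
`Mat S` with the group C*-algebra of `ℤ`. -/
abbrev MatZ (S : Type*) := L2Z S →L[ℂ] L2Z S

section general

variable {I J E F : Type*} [NormedAddCommGroup E] [NormedSpace ℂ E]
  [NormedAddCommGroup F] [NormedSpace ℂ F]

lemma summable_sq (ξ : lp (fun _ : I => E) 2) : Summable fun i => ‖ξ i‖ ^ 2 := by
  have h := (lp.memℓp ξ).summable (by norm_num)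
  simpa using h

lemma norm_sq_eq (ξ : lp (fun _ : I => E) 2) : ‖ξ‖ ^ 2 = ∑' i, ‖ξ i‖ ^ 2 := by
  have h := lp.norm_rpow_eq_tsum (p := 2) (by norm_num) ξ
  simpa using h

lemma comp_bound (φ : J → I) (T : J → E →L[ℂ] F) {C : ℝ}
    (hT : ∀ j, ‖T j‖ ≤ C) (ξ : lp (fun _ : I => E) 2) (j : J) :
    ‖T j (ξ (φ j))‖ ^ 2 ≤ C ^ 2 * ‖ξ (φ j)‖ ^ 2 := by
  rw [← mul_pow]
  have h1 : ‖T j (ξ (φ j))‖ ≤ C * ‖ξ (φ j)‖ :=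
    ((T j).le_opNorm _).trans (mul_le_mul_of_nonneg_right (hT j) (norm_nonneg _))
  exact pow_le_pow_left₀ (norm_nonneg _) h1 2

lemma comp_summable (φ : J → I) (hφ : Function.Injective φ) (T : J → E →L[ℂ] F) {C : ℝ}
    (hT : ∀ j, ‖T j‖ ≤ C) (ξ : lp (fun _ : I => E) 2) :
    Summable fun j => ‖T j (ξ (φ j))‖ ^ 2 :=
  Summable.of_nonneg_of_le (fun _ => by positivity) (comp_bound φ T hT ξ)
    (((summable_sq ξ).comp_injective hφ).mul_left (C ^ 2))

/-- For an injective map `φ` and a uniformly bounded family `T` of operators, the bounded operator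
between `ℓ²`-spaces that sends `ξ` to `j ↦ T j (ξ (φ j))`. -/
def compOp (φ : J → I) (hφ : Function.Injective φ) (T : J → E →L[ℂ] F) (C : ℝ)
    (hC : 0 ≤ C) (hT : ∀ j, ‖T j‖ ≤ C) : lp (fun _ : I => E) 2 →L[ℂ] lp (fun _ : J => F) 2 :=
  LinearMap.mkContinuous
    { toFun := fun ξ => ⟨fun j => T j (ξ (φ j)),
        memℓp_gen (by simpa using comp_summable φ hφ T hT ξ)⟩
      map_add' := fun ξ η => by
        ext1
        funext j
        exact map_add (T j) (ξ (φ j)) (η (φ j))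
      map_smul' := fun c ξ => by
        ext1
        funext j
        exact map_smul (T j) c (ξ (φ j)) }
    C (fun ξ => by
      refine le_of_sq_le_sq ?_ (by positivity)
      rw [norm_sq_eq, mul_pow, norm_sq_eq]
      calc ∑' j, ‖T j (ξ (φ j))‖ ^ 2
          ≤ ∑' j, C ^ 2 * ‖ξ (φ j)‖ ^ 2 :=
            (comp_summable φ hφ T hT ξ).tsum_le_tsum (comp_bound φ T hT ξ)
              (((summable_sq ξ).comp_injective hφ).mul_left (C ^ 2))
        _ = C ^ 2 * ∑' j, ‖ξ (φ j)‖ ^ 2 := tsum_mul_left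
        _ ≤ C ^ 2 * ∑' i, ‖ξ i‖ ^ 2 := by
            refine mul_le_mul_of_nonneg_left ?_ (by positivity)
            exact tsum_comp_le_tsum_of_inj (summable_sq ξ) (fun _ => by positivity) hφ)

@[simp] lemma compOp_apply (φ : J → I) (hφ : Function.Injective φ) (T : J → E →L[ℂ] F) (C : ℝ)
    (hC : 0 ≤ C) (hT : ∀ j, ‖T j‖ ≤ C) (ξ : lp (fun _ : I => E) 2) (j : J) :
    compOp φ hφ T C hC hT ξ j = T j (ξ (φ j)) := rfl

end general

section matrices

variable {S : Type*}

open Classical in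
/-- The standard basis vector of `ℓ²(S)` at `x`. -/
def e (x : S) : L2 S := lp.single 2 x (1 : ℂ)

open Classical in
lemma e_apply (x y : S) : e x y = if y = x then 1 else 0 := by
  simp [e, Pi.single_apply]

lemma inner_e (x : S) (ξ : L2 S) : inner ℂ (e x) ξ = ξ x := by
  classical
  simp [e, lp.inner_single_left]

/-- The `(x, y)`-entry of a matrix. -/
def entry (α : Mat S) (x y : S) : ℂ := inner ℂ (e x) (α (e y))

/-- A matrix is diagonal if `x = y` whenever its `(x, y)`-entry does not vanish. -/
def IsDiagonal (α : Mat S) : Prop := ∀ x y, entry α x y ≠ 0 → x = y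

/-- A matrix is quasi-monomial if it has at most one non-vanishing entry in each row and in each
column. -/
def IsQuasiMonomial (α : Mat S) : Prop :=
  (∀ x y z, entry α x y ≠ 0 → entry α x z ≠ 0 → y = z) ∧
  (∀ x y z, entry α x z ≠ 0 → entry α y z ≠ 0 → x = y)

/-- The bounded operator `ξ ↦ ξ ∘ φ`, for `φ` injective. -/
def pull (φ : S → S) (hφ : Function.Injective φ) : Mat S :=
  compOp φ hφ (fun _ => ContinuousLinearMap.id ℂ ℂ) 1 zero_le_one
    (fun _ => ContinuousLinearMap.norm_id_le)

/-- The isometry with `e y ↦ e (φ y)`, for `φ` injective. -/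
def push (φ : S → S) (hφ : Function.Injective φ) : Mat S :=
  ContinuousLinearMap.adjoint (pull φ hφ)

/-- The multiplication operator by the bounded function `a ∘ τ`. -/
def mulOp {Y : Type*} [TopologicalSpace Y] [CompactSpace Y] (a : C(Y, ℂ)) (τ : S → Y) : Mat S :=
  compOp id Function.injective_id (fun x => a (τ x) • ContinuousLinearMap.id ℂ ℂ) ‖a‖
    (norm_nonneg a) (fun x => by
      rw [norm_smul]
      refine (mul_le_of_le_one_right (norm_nonneg _) ContinuousLinearMap.norm_id_le).trans ?_
      exact a.norm_coe_le_norm _)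

lemma pull_e_same (φ : S → S) (hφ : Function.Injective φ) (x : S) :
    pull φ hφ (e (φ x)) = e x := by
  classical
  ext y
  simp [pull, e_apply, hφ.eq_iff]

lemma pull_e_of_notMem (φ : S → S) (hφ : Function.Injective φ) (y : S) (hy : y ∉ range φ) :
    pull φ hφ (e y) = 0 := by
  classical
  ext x
  have : φ x ≠ y := fun h => hy ⟨x, h⟩
  simp [pull, e_apply, this]

lemma push_e (φ : S → S) (hφ : Function.Injective φ) (y : S) :
    push φ hφ (e y) = e (φ y) := by
  classical
  ext x
  rw [← inner_e, push, ContinuousLinearMap.adjoint_inner_right, ← inner_conj_symm, inner_e]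
  simp only [pull, compOp_apply, e_apply, ContinuousLinearMap.id_apply]
  by_cases h : φ y = x
  · simp [h]
  · simp [h, Ne.symm h]

lemma mulOp_e {Y : Type*} [TopologicalSpace Y] [CompactSpace Y] (a : C(Y, ℂ)) (τ : S → Y)
    (y : S) : mulOp a τ (e y) = a (τ y) • e y := by
  classical
  ext x
  by_cases h : x = y
  · simp [mulOp, e_apply, h]
  · simp [mulOp, e_apply, h]

/-- The elementary tensor `α ⊗ υ n`, where `υ n` is the `n`-th bilateral shift on `ℓ²(ℤ)`, i.e.
`υ n (e k) = e (n + k)`. On `ℓ²(ℤ, ℓ²(S))` it sends `ξ` to `k ↦ α (ξ (k - n))`. -/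
def tens (α : Mat S) (n : ℤ) : MatZ S :=
  compOp (fun k : ℤ => k - n) (sub_left_injective) (fun _ => α) ‖α‖ (norm_nonneg α)
    (fun _ => le_rfl)

lemma tens_single (α : Mat S) (n k : ℤ) (v : L2 S) :
    tens α n (lp.single 2 k v) = lp.single 2 (n + k) (α v) := by
  ext1
  funext i
  by_cases h : i = n + k
  · subst h
    simp [tens]
  · have h' : i - n ≠ k := fun h' => h (by omega)
    simp [tens, h, h']

end matrices

/-! ### C*-subalgebras, normalizers and regularity -/

section cstar

variable {M : Type*} [CStarAlgebra M]

/-- The C*-subalgebra generated by a subset. -/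
def cstarGen (s : Set M) : NonUnitalStarSubalgebra ℂ M :=
  (NonUnitalStarAlgebra.adjoin ℂ s).topologicalClosure

/-- `A` is (the underlying set of) a C*-subalgebra of `B`. -/
def IsCStarSubalgebra (A B : Set M) : Prop :=
  A ⊆ B ∧ ∃ T : NonUnitalStarSubalgebra ℂ M, (T : Set M) = A ∧ IsClosed A

/-- The normalizer of `A` in `B`. -/
def normalizer (A B : Set M) : Set M :=
  {b | b ∈ B ∧ (∀ a ∈ A, b * a * star b ∈ A) ∧ ∀ a ∈ A, star b * a * b ∈ A}

/-- `A` is regular in `B`: the normalizer of `A` in `B` generates `B` as a C*-algebra. -/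
def IsRegular (A B : Set M) : Prop := (cstarGen (normalizer A B) : Set M) = B

end cstar

/-! ### Iterated function systems -/

section ifs

variable {X : Type*} {N : ℕ}

/-- The `γ`-orbit `x, γ (k 0) x, γ (k 1) (γ (k 0) x), …` of `x` along an index sequence `k`. -/
def orbit (γ : Fin N → X → X) {n : ℕ} (k : Fin n → Fin N) (x : X) (i : Fin (n + 1)) : X :=
  Fin.induction (motive := fun _ => X) x (fun i y => γ (k i) y) i

/-- The composition `γ (k (n-1)) ∘ ⋯ ∘ γ (k 0)`. -/
def word (γ : Fin N → X → X) {n : ℕ} (k : Fin n → Fin N) (x : X) : X :=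
  orbit γ k x (Fin.last n)

@[simp] lemma orbit_zero (γ : Fin N → X → X) {n : ℕ} (k : Fin n → Fin N) (x : X) :
    orbit γ k x 0 = x := rfl

@[simp] lemma orbit_succ (γ : Fin N → X → X) {n : ℕ} (k : Fin n → Fin N) (x : X) (i : Fin n) :
    orbit γ k x i.succ = γ (k i) (orbit γ k x i.castSucc) := by
  simp [orbit]

lemma orbit_inj (γ : Fin N → X → X) {S : Set X} (hm : ∀ k, MapsTo (γ k) S S)
    (hi : ∀ k, InjOn (γ k) S) {n : ℕ} (k : Fin n → Fin N) (i : Fin (n + 1)) :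
    MapsTo (fun x => orbit γ k x i) S S ∧ InjOn (fun x => orbit γ k x i) S := by
  induction i using Fin.induction with
  | zero => exact ⟨fun x hx => hx, fun x _ y _ h => h⟩
  | succ i ih =>
    simp only [orbit_succ]
    exact ⟨(hm _).comp ih.1, (hi _).comp ih.2 ih.1⟩

variable [TopologicalSpace X]

/-- `γ(S)`, the union of the images of `S` under the maps of the system. -/
def ifsImage (γ : Fin N → C(X, X)) (S : Set X) : Set X := ⋃ k, γ k '' S

/-- The graph separation condition. -/
def GraphSeparation (γ : Fin N → C(X, X)) : Prop :=
  ∀ j k, j ≠ k → ∀ x, γ j x ≠ γ k x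

/-- Essential freeness: distinct finite index sequences (of possibly different lengths) give maps
that agree only on a nowhere dense set. -/
def EssentiallyFree (γ : Fin N → C(X, X)) : Prop :=
  ∀ j k : (n : ℕ) × (Fin n → Fin N), j ≠ k →
    IsNowhereDense {x | word (fun i => γ i) j.2 x = word (fun i => γ i) k.2 x}

/-- Complete invariance of a subset. -/
def CompletelyInvariant (γ : Fin N → C(X, X)) (S : Set X) : Prop :=
  ∀ k, γ k '' S ⊆ S ∧ γ k ⁻¹' S ⊆ S

/-- The conditions on the index set `S` of the matrices under which the representations below are
defined. -/
structure IsAdmissible (γ : Fin N → C(X, X)) (S : Set X) : Prop where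
  dense : Dense S
  completelyInvariant : CompletelyInvariant γ S
  disjoint : Pairwise fun j k => Disjoint (γ j '' S) (γ k '' S)
  injOn : ∀ k, InjOn (γ k) S

/-- The graph of the system. -/
def graph (γ : Fin N → C(X, X)) : Set (X × X) := {p | ∃ k, p.1 = γ k p.2}

/-- The space of `γ`-chains of length `n`. A chain is indexed from its starting point:
`c 0` is the starting point and `c (i + 1)` is an image of `c i`. -/
def chains (γ : Fin N → C(X, X)) (n : ℕ) : Set (Fin (n + 1) → X) :=
  {c | ∀ i : Fin n, ∃ k, c i.succ = γ k (c i.castSucc)}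

/-- The space of `γ`-bichains of length `(m, n)`: pairs of chains with the same starting point. -/
def bichains (γ : Fin N → C(X, X)) (m n : ℕ) : Set ((Fin (m + 1) → X) × (Fin (n + 1) → X)) :=
  {p | p.1 ∈ chains γ m ∧ p.2 ∈ chains γ n ∧ p.1 0 = p.2 0}

lemma orbit_mem_chains (γ : Fin N → C(X, X)) {n : ℕ} (k : Fin n → Fin N) (x : X) :
    orbit (fun i => γ i) k x ∈ chains γ n :=
  fun i => ⟨k i, orbit_succ _ k x i⟩

section compactness

variable [CompactSpace X] [T2Space X]

lemma isClosed_graph (γ : Fin N → C(X, X)) : IsClosed (graph γ) := by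
  have : graph γ = ⋃ k, {p : X × X | p.1 = γ k p.2} := by
    ext p
    simp [graph]
  rw [this]
  exact isClosed_iUnion_of_finite fun k =>
    isClosed_eq continuous_fst ((γ k).continuous.comp continuous_snd)

lemma isClosed_chains (γ : Fin N → C(X, X)) (n : ℕ) : IsClosed (chains γ n) := by
  have : chains γ n = ⋂ i : Fin n, ⋃ k, {c | c i.succ = γ k (c i.castSucc)} := by
    ext p
    simp [chains]
  rw [this]
  exact isClosed_iInter fun i => isClosed_iUnion_of_finite fun k =>
    isClosed_eq (continuous_apply _) ((γ k).continuous.comp (continuous_apply _))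

lemma isClosed_bichains (γ : Fin N → C(X, X)) (m n : ℕ) : IsClosed (bichains γ m n) :=
  ((isClosed_chains γ m).preimage continuous_fst).inter
    (((isClosed_chains γ n).preimage continuous_snd).inter
      (isClosed_eq ((continuous_apply 0).comp continuous_fst)
        ((continuous_apply 0).comp continuous_snd)))

instance (γ : Fin N → C(X, X)) : CompactSpace (graph γ) :=
  isCompact_iff_compactSpace.mp (isClosed_graph γ).isCompact

instance (γ : Fin N → C(X, X)) (m n : ℕ) : CompactSpace (bichains γ m n) :=
  isCompact_iff_compactSpace.mp (isClosed_bichains γ m n).isCompact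

end compactness

/-- The point `(γ k y, y)` of the graph. -/
def graphPt (γ : Fin N → C(X, X)) (k : Fin N) (y : X) : graph γ := ⟨(γ k y, y), k, rfl⟩

/-- The bichain formed by the orbits of `x` along two index sequences. -/
def bichainPt (γ : Fin N → C(X, X)) {m n : ℕ} (j : Fin m → Fin N) (k : Fin n → Fin N) (x : X) :
    bichains γ m n :=
  ⟨(orbit (fun i => γ i) j x, orbit (fun i => γ i) k x),
    orbit_mem_chains γ j x, orbit_mem_chains γ k x, rfl⟩

variable {γ : Fin N → C(X, X)} {S : Set X}

namespace IsAdmissible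

lemma mapsTo (h : IsAdmissible γ S) (k : Fin N) : MapsTo (γ k) S S :=
  fun _ hx => (h.completelyInvariant k).1 ⟨_, hx, rfl⟩

/-- The restriction of `γ k` to `S`. -/
def res (h : IsAdmissible γ S) (k : Fin N) : S → S := (h.mapsTo k).restrict

lemma res_injective (h : IsAdmissible γ S) (k : Fin N) : Function.Injective (h.res k) :=
  (h.mapsTo k).restrict_inj.mpr (h.injOn k)

lemma word_mapsTo (h : IsAdmissible γ S) {n : ℕ} (k : Fin n → Fin N) :
    MapsTo (word (fun i => γ i) k) S S :=
  (orbit_inj (fun i => γ i) h.mapsTo h.injOn k (Fin.last n)).1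

/-- The restriction to `S` of the composition along an index sequence. -/
def resWord (h : IsAdmissible γ S) {n : ℕ} (k : Fin n → Fin N) : S → S :=
  (h.word_mapsTo k).restrict

lemma resWord_injective (h : IsAdmissible γ S) {n : ℕ} (k : Fin n → Fin N) :
    Function.Injective (h.resWord k) :=
  (h.word_mapsTo k).restrict_inj.mpr
    (orbit_inj (fun i => γ i) h.mapsTo h.injOn k (Fin.last n)).2

end IsAdmissible

/-! ### The representations -/

variable [CompactSpace X]

/-- `ρ_A(a) e_x = a(x) e_x`. -/
def rhoA (S : Set X) (a : C(X, ℂ)) : Mat S := mulOp a Subtype.val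

lemma rhoA_e (S : Set X) (a : C(X, ℂ)) (x : S) : rhoA S a (e x) = a x • e x :=
  mulOp_e _ _ _

variable [T2Space X]

/-- `ρ_E(f) e_y = ∑ k, f(γ_k(y), y) e_{γ_k(y)}`, for a continuous function `f` on the graph. -/
def rhoE (h : IsAdmissible γ S) (f : C(graph γ, ℂ)) : Mat S :=
  ∑ k, push (h.res k) (h.res_injective k) * mulOp f fun y : S => graphPt γ k y

lemma rhoE_e (h : IsAdmissible γ S) (f : C(graph γ, ℂ)) (y : S) :
    rhoE h f (e y) = ∑ k, f (graphPt γ k y) • e (h.res k y) := by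
  simp [rhoE, mulOp_e, push_e]

/-- `ρ_{m,n}(f)` for a continuous function `f` on the space of bichains of length `(m, n)`: the
vector `e_{γ_k(x)}`, with `k` of length `n` and `x` in `S`, is sent to the sum over all `j` of
length `m` of `f(orbit of x along j, orbit of x along k) e_{γ_j(x)}`, and `e_y` is sent to `0` if
`y` is not in `γⁿ(S)`; see `rhoMN_e` and `rhoMN_e_of_notMem`. -/
def rhoMN (h : IsAdmissible γ S) (m n : ℕ) (f : C(bichains γ m n, ℂ)) : Mat S :=
  ∑ k : Fin n → Fin N, ∑ j : Fin m → Fin N,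
    push (h.resWord j) (h.resWord_injective j) * mulOp f (fun x : S => bichainPt γ j k x) *
      pull (h.resWord k) (h.resWord_injective k)

lemma orbit_word_inj (h : IsAdmissible γ S) {n : ℕ} (k l : Fin n → Fin N) {x y : X} (hx : x ∈ S)
    (hy : y ∈ S) (i : Fin (n + 1))
    (hxy : orbit (fun i => γ i) k x i = orbit (fun i => γ i) l y i) :
    ∀ r : Fin n, r.castSucc < i → k r = l r := by
  induction i using Fin.induction with
  | zero => intro r hr; exact absurd hr (Fin.not_lt_zero _)
  | succ i ih =>
    simp only [orbit_succ] at hxy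
    have mk := (orbit_inj (fun i => γ i) h.mapsTo h.injOn k i.castSucc).1 hx
    have ml := (orbit_inj (fun i => γ i) h.mapsTo h.injOn l i.castSucc).1 hy
    have hkl : k i = l i := by
      by_contra hne
      exact Set.disjoint_left.mp (h.disjoint hne) ⟨_, mk, rfl⟩ ⟨_, ml, hxy.symm⟩
    rw [hkl] at hxy
    have hprev := h.injOn (l i) mk ml hxy
    intro r hr
    rcases (Fin.castSucc_lt_succ_iff.mp hr).lt_or_eq with h1 | h1
    · exact ih hprev r (Fin.castSucc_lt_castSucc_iff.mpr h1)
    · rw [h1, hkl]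

lemma rhoMN_e (h : IsAdmissible γ S) (m n : ℕ) (f : C(bichains γ m n, ℂ)) (k : Fin n → Fin N)
    (x : S) :
    rhoMN h m n f (e (h.resWord k x)) =
      ∑ j : Fin m → Fin N, f (bichainPt γ j k x) • e (h.resWord j x) := by
  rw [rhoMN, sum_apply, Finset.sum_eq_single k]
  · simp [pull_e_same, mulOp_e, push_e]
  · intro l _ hl
    have : h.resWord k x ∉ range (h.resWord l) := by
      rintro ⟨y, hy⟩
      refine hl (funext fun r => ?_)
      exact orbit_word_inj h l k y.2 x.2 (Fin.last n) (congrArg Subtype.val hy) r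
        (Fin.castSucc_lt_last r)
    simp [pull_e_of_notMem _ _ _ this]
  · simp

lemma rhoMN_e_of_notMem (h : IsAdmissible γ S) (m n : ℕ) (f : C(bichains γ m n, ℂ)) (y : S)
    (hy : ∀ k : Fin n → Fin N, y ∉ range (h.resWord k)) : rhoMN h m n f (e y) = 0 := by
  simp [rhoMN, pull_e_of_notMem _ _ _ (hy _)]

/-- `C*(ρ)`, the C*-subalgebra generated by the ranges of `ρ_A` and `ρ_E`. -/
def cstarRho (h : IsAdmissible γ S) : Set (Mat S) :=
  cstarGen (range (rhoA S) ∪ range (rhoE h))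

/-- `C*(ρ̂)`, the C*-subalgebra generated by all `ρ_A(a) ⊗ υ 0` and all `ρ_E(f) ⊗ υ 1`. -/
def cstarRhoHat (h : IsAdmissible γ S) : Set (MatZ S) :=
  cstarGen ((range fun a => tens (rhoA S a) 0) ∪ range fun f => tens (rhoE h f) 1)

/-- `B_k`, the closed linear span of the ranges `E_{m,n}` of `ρ_{m,n}` with `m - n = k`. -/
def B (h : IsAdmissible γ S) (k : ℤ) : Submodule ℂ (Mat S) :=
  (Submodule.span ℂ
    {α | ∃ m n : ℕ, (m : ℤ) - n = k ∧ α ∈ range (rhoMN h m n)}).topologicalClosure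

/-- `D_k`, the set of all diagonal matrices in `B_k`. -/
def D (h : IsAdmissible γ S) (k : ℤ) : Set (Mat S) := {α | α ∈ B h k ∧ IsDiagonal α}

/-- `D̂`, the closed direct sum of the subspaces `D_k ⊗ υ k`. -/
def DHat (h : IsAdmissible γ S) : Set (MatZ S) :=
  (Submodule.span ℂ {ξ | ∃ k : ℤ, ∃ α ∈ D h k, ξ = tens α k}).topologicalClosure

end ifs

end KW

end

/-!
Let `T = ρ_E(1)`, so that `T e_y = ∑ k, e_{γ_k(y)}`. Because `σ` inverts every map of the system, a
chain is determined by its end point, and by the Stone–Weierstrass theorem `B_k` is the closed span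
of the monomials `a Tᵐ T*ⁿ b` with `m - n = k` and `a, b ∈ C(X)` (`B_eq`). The relations
`T* a T = ∑ k, a ∘ γ_k` and `T a = (a ∘ σ) T` turn these spans into a graded `*`-algebra which is
dense in `C*(ρ)`; this gives the C*-algebra structure of `D_0` and of `D̂`. The entries of a
monomial are explicit (`entry_mono`): the entry at `(x, y)` is `a(x) b(y)` if `x` and `y` have the common
ancestor `σ^m(x) = σ^n(y)`, and `0` otherwise.

By essential freeness and Baire's theorem the *aperiodic* points, those with pairwise distinct
ancestors, are dense (`dense_aperiodic`). Over an aperiodic point the degree `m - n` of a common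
ancestor is determined by `x` and `y`.

*The normalizer of `D_0`.* If `b` normalizes `D_0`, then `b a b*` and `b* a b` are diagonal for all
`a ∈ C(X)`; letting `a` shrink to a point mass shows that `b` is quasi-monomial. Conversely, if `b`
is quasi-monomial and `α` is diagonal, then `b α b*` is diagonal, so it suffices to see that every
diagonal matrix in `C*(ρ)` lies in `B_0` (`mem_D_of_isDiagonal`). Approximate a diagonal `α` by a
sum `β` of monomials. Along the forward orbit of an aperiodic point the length of words is a grading
which separates the degrees in `β`, so there the part of `β` of non-zero degree is small. That this
part is small as an operator (`norm_sum_mono_le`) is not automatic, as the points of `S` may be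
periodic: their orbits are unrolled, which makes the matrices limits of those over aperiodic points,
and an averaging over finitely many levels (amenability of `ℤ`) undoes the unrolling.

*Graph separation implies regularity.* The sets `γ_k(X)` are then clopen and disjoint, and `T` is
the sum of the quasi-monomial operators `1_{γ_k(X)} T`, which normalize `D_0`, and `D̂` after
tensoring with the shift.

*Regularity implies graph separation.* Suppose `γ_j(x) = γ_k(x)` with `j ≠ k`, and let `p → x` be
aperiodic. For all `b ∈ C*(ρ)` the entries of `b` at `(γ_j(p), p)` and at `(γ_k(p), p)` become equal
in the limit, while for a normalizer `b` one of them vanishes, so that both tend to zero. Products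
and adjoints of normalizers are normalizers; hence the C*-algebra generated by them is their closed
linear span, and does not contain `T`, whose entries at these places are `1`. The same argument
applies to `D̂`.
-/

set_option linter.unusedSectionVars false

namespace KW

/-! ### Dynamics of the left inverse `σ` -/

section dynamics

variable {X : Type*} [TopologicalSpace X] {N : ℕ} {γ : Fin N → C(X, X)} {S : Set X} {σ : X → X}

/-- The set `γⁿ(X)` of the points with at least `n` generations of ancestors. -/
def iter (γ : Fin N → C(X, X)) (n : ℕ) : Set X := (ifsImage γ)^[n] univ

@[simp] lemma mem_iter_zero (x : X) : x ∈ iter γ 0 := mem_univ x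

lemma mem_iter_succ {n : ℕ} {x : X} : x ∈ iter γ (n + 1) ↔ ∃ k, ∃ y ∈ iter γ n, γ k y = x := by
  rw [iter, Function.iterate_succ_apply']
  simp [ifsImage, iter]

lemma apply_mem_iter_succ (hσ : ∀ k x, σ (γ k x) = x) {k : Fin N} {n : ℕ} {y : X} :
    γ k y ∈ iter γ (n + 1) ↔ y ∈ iter γ n := by
  rw [mem_iter_succ]
  constructor
  · rintro ⟨j, z, hz, hzy⟩
    have := congrArg σ hzy
    rw [hσ, hσ] at this
    exact this ▸ hz
  · exact fun h => ⟨k, y, h, rfl⟩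

lemma mem_iter_add (hσ : ∀ k x, σ (γ k x) = x) {m n : ℕ} {x : X} :
    x ∈ iter γ (m + n) ↔ x ∈ iter γ m ∧ σ^[m] x ∈ iter γ n := by
  induction m generalizing x with
  | zero => simp
  | succ m ih =>
    rw [show m + 1 + n = m + n + 1 by omega]
    constructor
    · intro h
      obtain ⟨k, y, hy, rfl⟩ := mem_iter_succ.mp h
      rw [ih] at hy
      exact ⟨(apply_mem_iter_succ hσ).mpr hy.1, by
        rw [Function.iterate_succ_apply, hσ]; exact hy.2⟩
    · rintro ⟨h1, h2⟩
      obtain ⟨k, y, hy, rfl⟩ := mem_iter_succ.mp h1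
      rw [Function.iterate_succ_apply, hσ] at h2
      exact (apply_mem_iter_succ hσ).mpr (ih.mpr ⟨hy, h2⟩)

lemma mem_iter_of_le (hσ : ∀ k x, σ (γ k x) = x) {m n : ℕ} (hmn : m ≤ n) {x : X}
    (h : x ∈ iter γ n) : x ∈ iter γ m := by
  obtain ⟨d, rfl⟩ := Nat.exists_eq_add_of_le hmn
  exact ((mem_iter_add hσ).mp h).1

lemma sigma_iter_mem (h : IsAdmissible γ S) (hσ : ∀ k x, σ (γ k x) = x) {n : ℕ} {x : X}
    (hx : x ∈ S) (hn : x ∈ iter γ n) : σ^[n] x ∈ S := by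
  induction n generalizing x with
  | zero => exact hx
  | succ n ih =>
    obtain ⟨k, y, hy, rfl⟩ := mem_iter_succ.mp hn
    rw [Function.iterate_succ_apply, hσ]
    exact ih ((h.completelyInvariant k).2 hx) hy

lemma continuousOn_sigma_iter (hσ : ∀ k x, σ (γ k x) = x)
    (hc : ContinuousOn σ (ifsImage γ univ)) (n : ℕ) : ContinuousOn σ^[n] (iter γ n) := by
  induction n with
  | zero => exact continuousOn_id
  | succ n ih =>
    rw [Function.iterate_succ]
    refine ih.comp (hc.mono fun x hx => ?_) fun x hx => ?_
    · exact mem_iter_of_le hσ (Nat.le_add_left 1 n) hx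
    · obtain ⟨k, y, hy, rfl⟩ := mem_iter_succ.mp hx
      rwa [hσ]

/-- `x` and `y` have the common ancestor `σ^m(x) = σ^n(y)`, where both sides are honest iterated
preimages: `σ` is only meaningful on `γ(X)`. -/
def Meets (γ : Fin N → C(X, X)) (σ : X → X) (m n : ℕ) (x y : X) : Prop :=
  x ∈ iter γ m ∧ y ∈ iter γ n ∧ σ^[m] x = σ^[n] y

lemma Meets.symm {m n : ℕ} {x y : X} (h : Meets γ σ m n x y) : Meets γ σ n m y x :=
  ⟨h.2.1, h.1, h.2.2.symm⟩

lemma Meets.add (hσ : ∀ k x, σ (γ k x) = x) {m n d : ℕ} {x y : X} (h : Meets γ σ m n x y)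
    (hd : x ∈ iter γ (m + d)) : Meets γ σ (m + d) (n + d) x y := by
  refine ⟨hd, (mem_iter_add hσ).mpr ⟨h.2.1, h.2.2 ▸ ((mem_iter_add hσ).mp hd).2⟩, ?_⟩
  rw [add_comm m, add_comm n, Function.iterate_add_apply, Function.iterate_add_apply, h.2.2]

/-- The composition of the maps of the system along a word; the last letter is applied first. -/
def wd (γ : Fin N → C(X, X)) (l : List (Fin N)) (x : X) : X := l.foldr (fun k y => γ k y) x

@[simp] lemma wd_nil (x : X) : wd γ [] x = x := rfl

@[simp] lemma wd_cons (k : Fin N) (l : List (Fin N)) (x : X) :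
    wd γ (k :: l) x = γ k (wd γ l x) := rfl

lemma continuous_wd (l : List (Fin N)) : Continuous (wd γ l) := by
  induction l with
  | nil => exact continuous_id
  | cons k l ih => exact (γ k).continuous.comp ih

lemma wd_mem (h : IsAdmissible γ S) (l : List (Fin N)) {x : X} (hx : x ∈ S) : wd γ l x ∈ S := by
  induction l with
  | nil => exact hx
  | cons k l ih => exact h.mapsTo k ih

lemma wd_mem_iter (hσ : ∀ k x, σ (γ k x) = x) (l : List (Fin N)) {n : ℕ} {x : X} :
    wd γ l x ∈ iter γ (l.length + n) ↔ x ∈ iter γ n := by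
  induction l with
  | nil => simp
  | cons k l ih =>
    rw [List.length_cons, add_right_comm, wd_cons, apply_mem_iter_succ hσ, ih]

lemma wd_mem_iter_of_le (hσ : ∀ k x, σ (γ k x) = x) {l : List (Fin N)} {n : ℕ}
    (h : n ≤ l.length) (x : X) : wd γ l x ∈ iter γ n :=
  mem_iter_of_le hσ h ((wd_mem_iter (n := 0) hσ l).mpr (mem_iter_zero x))

lemma sigma_iter_wd (hσ : ∀ k x, σ (γ k x) = x) {l : List (Fin N)} {n : ℕ} (h : n ≤ l.length)
    (x : X) : σ^[n] (wd γ l x) = wd γ (l.drop n) x := by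
  induction n generalizing l with
  | zero => simp
  | succ n ih =>
    cases l with
    | nil => simp at h
    | cons k l =>
      rw [Function.iterate_succ_apply, wd_cons, hσ, List.drop_succ_cons]
      exact ih (by simpa using h)

lemma exists_wd (hσ : ∀ k x, σ (γ k x) = x) {n : ℕ} {x : X} (h : x ∈ iter γ n) :
    ∃ l : List (Fin N), l.length = n ∧ wd γ l (σ^[n] x) = x := by
  induction n generalizing x with
  | zero => exact ⟨[], rfl, rfl⟩
  | succ n ih =>
    obtain ⟨k, y, hy, rfl⟩ := mem_iter_succ.mp h
    obtain ⟨l, hl, hly⟩ := ih hy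
    exact ⟨k :: l, by simp [hl], by rw [Function.iterate_succ_apply, hσ, wd_cons, hly]⟩

lemma wd_injective (h : IsAdmissible γ S) {l l' : List (Fin N)} {z : X} (hz : z ∈ S)
    (hl : l.length = l'.length) (hw : wd γ l z = wd γ l' z) : l = l' := by
  induction l generalizing l' with
  | nil => exact (List.length_eq_zero_iff.mp hl.symm).symm
  | cons k l ih =>
    cases l' with
    | nil => simp at hl
    | cons j l' =>
      have hkj : k = j := by
        by_contra hne
        exact Set.disjoint_left.mp (h.disjoint hne) ⟨_, wd_mem h l hz, rfl⟩
          ⟨_, wd_mem h l' hz, hw.symm⟩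
      subst hkj
      rw [ih (by simpa using hl) (h.injOn k (wd_mem h l hz) (wd_mem h l' hz) hw)]

lemma word_succ {n : ℕ} (k : Fin (n + 1) → Fin N) (x : X) :
    word (fun i => γ i) k x =
      γ (k (Fin.last n)) (word (fun i => γ i) (fun i => k i.castSucc) x) := by
  have h : ∀ i : Fin (n + 1), orbit (fun i => γ i) k x i.castSucc =
      orbit (fun i => γ i) (fun i => k i.castSucc) x i := by
    intro i
    induction i using Fin.induction with
    | zero => rfl
    | succ i ih => rw [← Fin.succ_castSucc, orbit_succ, orbit_succ, ih]
  rw [word, ← Fin.succ_last, orbit_succ, h]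
  rfl

lemma word_eq_wd {n : ℕ} (k : Fin n → Fin N) (x : X) :
    word (fun i => γ i) k x = wd γ (List.ofFn k).reverse x := by
  induction n with
  | zero => rfl
  | succ n ih =>
    rw [word_succ, ih, List.ofFn_succ']
    simp

lemma wd_eq_word (l : List (Fin N)) (x : X) :
    wd γ l x = word (fun i => γ i) l.reverse.get x := by
  rw [word_eq_wd, List.ofFn_get, List.reverse_reverse]

lemma exists_word_iff (hσ : ∀ k x, σ (γ k x) = x) {n : ℕ} {x z : X} :
    (∃ k : Fin n → Fin N, word (fun i => γ i) k z = x) ↔ x ∈ iter γ n ∧ σ^[n] x = z := by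
  constructor
  · rintro ⟨k, rfl⟩
    rw [word_eq_wd]
    refine ⟨wd_mem_iter_of_le hσ (by simp) z, ?_⟩
    rw [sigma_iter_wd hσ (by simp), List.drop_of_length_le (by simp)]
    rfl
  · rintro ⟨hx, rfl⟩
    obtain ⟨l, rfl, hl⟩ := exists_wd hσ hx
    refine ⟨fun i => l.reverse.get (i.cast (by simp)), ?_⟩
    rw [word_eq_wd]
    have : List.ofFn (fun i : Fin l.length => l.reverse.get (i.cast (by simp))) = l.reverse :=
      List.ext_get (by simp) (by simp)
    rw [this, List.reverse_reverse, hl]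

/-! ### Aperiodic points -/

/-- The points of `S` whose ancestors `x, σ(x), σ²(x), …` (as far as they exist) are pairwise
distinct. -/
def aperiodic (γ : Fin N → C(X, X)) (σ : X → X) (S : Set X) : Set X :=
  {x | x ∈ S ∧ ∀ m n, Meets γ σ m n x x → m = n}

/-- The generation difference of two points with a common ancestor is well defined if one of them
is aperiodic. -/
lemma Meets.degree_unique (hσ : ∀ k x, σ (γ k x) = x) {a b c d : ℕ} {x y : X}
    (hy : y ∈ aperiodic γ σ S) (h1 : Meets γ σ a b x y) (h2 : Meets γ σ c d x y) :
    a + d = c + b := by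
  wlog hac : a ≤ c generalizing a b c d
  · exact (this h2 h1 (le_of_not_ge hac)).symm
  obtain ⟨e, rfl⟩ := Nat.exists_eq_add_of_le hac
  have h3 := h1.add hσ h2.1
  have := hy.2 d (b + e) ⟨h2.2.1, h3.2.1, h2.2.2.symm.trans h3.2.2⟩
  omega

lemma aperiodic_apply (h : IsAdmissible γ S) (hσ : ∀ k x, σ (γ k x) = x) {x : X}
    (hx : x ∈ aperiodic γ σ S) (k : Fin N) : γ k x ∈ aperiodic γ σ S := by
  refine ⟨h.mapsTo k hx.1, fun m n hmn => ?_⟩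
  -- If `γ k x` met itself at generation `0`, it would lie in `γ^(m+n)(X)`; one further step back
  -- reduces every coincidence to one for `x`.
  have key : ∀ m n, Meets γ σ m n (γ k x) (γ k x) → γ k x ∈ iter γ (m + 1) → m = n := by
    intro m n h1 h2
    have h3 := h1.add hσ h2
    refine hx.2 m n ⟨(apply_mem_iter_succ hσ).mp h3.1, (apply_mem_iter_succ hσ).mp h3.2.1, ?_⟩
    simpa only [Function.iterate_succ_apply, hσ] using h3.2.2
  rcases le_total m n with hle | hle
  · rcases hle.lt_or_eq with hlt | rfl
    · exact key m n hmn (mem_iter_of_le hσ hlt hmn.2.1)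
    · rfl
  · rcases hle.lt_or_eq with hlt | rfl
    · exact (key n m hmn.symm (mem_iter_of_le hσ hlt hmn.1)).symm
    · rfl

lemma aperiodic_wd (h : IsAdmissible γ S) (hσ : ∀ k x, σ (γ k x) = x) {x : X}
    (hx : x ∈ aperiodic γ σ S) (l : List (Fin N)) : wd γ l x ∈ aperiodic γ σ S := by
  induction l with
  | nil => exact hx
  | cons k l ih => exact aperiodic_apply h hσ ih k

lemma meets_wd (hσ : ∀ k x, σ (γ k x) = x) (l : List (Fin N)) (z : X) :
    Meets γ σ l.length 0 (wd γ l z) z :=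
  ⟨wd_mem_iter_of_le hσ le_rfl z, mem_iter_zero z, by
    rw [sigma_iter_wd hσ le_rfl, List.drop_length]; rfl⟩

/-- Words of arbitrary lengths act freely on aperiodic points. -/
lemma wd_injective_of_aperiodic (h : IsAdmissible γ S) (hσ : ∀ k x, σ (γ k x) = x)
    {z : X} (hz : z ∈ aperiodic γ σ S) : Function.Injective fun l => wd γ l z := by
  intro l l' hl
  have h1 := meets_wd hσ l z
  have h2 := meets_wd hσ l' z
  rw [show wd γ l z = wd γ l' z from hl] at h1
  have := h1.degree_unique hσ hz h2
  exact wd_injective h hz.1 (by omega) hl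

lemma length_of_meets_wd (h : IsAdmissible γ S) (hσ : ∀ k x, σ (γ k x) = x) {z : X}
    (hz : z ∈ aperiodic γ σ S) {l l' : List (Fin N)} {m n : ℕ}
    (hm : Meets γ σ m n (wd γ l z) (wd γ l' z)) : l.length + n = m + l'.length := by
  have h1 := meets_wd hσ l z
  have h2 := meets_wd hσ l' z
  exact Meets.degree_unique hσ (aperiodic_wd h hσ hz l')
    ⟨h1.1, h2.1, h1.2.2.trans h2.2.2.symm⟩ hm

/-- By essential freeness the aperiodic points are dense: a coincidence `σ^m = σ^n` with `m < n` on
an open set forces a non-empty word to act trivially on an open set. -/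
lemma dense_aperiodic [CompactSpace X] [T2Space X] (h : IsAdmissible γ S)
    (hσ : ∀ k x, σ (γ k x) = x) (hc : ContinuousOn σ (ifsImage γ univ))
    (hclopen : ∀ n, IsClopen (iter γ n)) (hres : S ∈ residual X) (hfree : EssentiallyFree γ) :
    Dense (aperiodic γ σ S) := by
  have hF : ∀ p : ℕ × ℕ, p.1 < p.2 →
      {x | x ∈ iter γ p.2 ∧ σ^[p.1] x = σ^[p.2] x}ᶜ ∈ residual X := by
    rintro ⟨m, n⟩ hmn
    have hm : ContinuousOn σ^[m] (iter γ n) :=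
      (continuousOn_sigma_iter hσ hc m).mono fun x hx => mem_iter_of_le hσ hmn.le hx
    have hclosed : IsClosed {x | x ∈ iter γ n ∧ σ^[m] x = σ^[n] x} :=
      ((hm.prodMk (continuousOn_sigma_iter hσ hc n)).preimage_isClosed_of_isClosed
        (hclopen n).isClosed isClosed_diagonal)
    refine residual_of_dense_open hclosed.isOpen_compl ?_
    rw [← interior_eq_empty_iff_dense_compl, eq_empty_iff_forall_notMem]
    intro x₀ hx₀
    obtain ⟨x, hxV, hxS⟩ := h.dense.inter_open_nonempty _ isOpen_interior ⟨x₀, hx₀⟩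
    obtain ⟨l, hl, hlx⟩ := exists_wd hσ (interior_subset hxV).1
    have hne : (⟨_, (l.drop m).reverse.get⟩ : (n : ℕ) × (Fin n → Fin N)) ≠ ⟨_, Fin.elim0⟩ := by
      intro heq
      have := congrArg Sigma.fst heq
      simp at this
      omega
    have hnd := hfree _ _ hne
    rw [IsNowhereDense] at hnd
    have hsub : wd γ l ⁻¹' interior {x | x ∈ iter γ n ∧ σ^[m] x = σ^[n] x} ⊆
        interior (closure {x | word (fun i => γ i) (l.drop m).reverse.get x =
          word (fun i => γ i) Fin.elim0 x}) := by
      refine (isOpen_interior.preimage (continuous_wd l)).subset_interior_iff.mpr ?_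
      refine Subset.trans (fun z hz => ?_) subset_closure
      have h1 := (interior_subset hz).2
      rw [sigma_iter_wd hσ (by omega), sigma_iter_wd hσ (by omega),
        List.drop_of_length_le (l := l) hl.le] at h1
      rw [mem_ofPred_eq, ← wd_eq_word, h1]
      rfl
    rw [hnd] at hsub
    have hmem : σ^[n] x ∈ wd γ l ⁻¹' interior {x | x ∈ iter γ n ∧ σ^[m] x = σ^[n] x} := by
      rw [mem_preimage, hlx]
      exact hxV
    exact hsub hmem
  have hcomeager : S ∩ ⋂ p : {p : ℕ × ℕ // p.1 < p.2},
      {x | x ∈ iter γ p.1.2 ∧ σ^[p.1.1] x = σ^[p.1.2] x}ᶜ ∈ residual X :=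
    Filter.inter_mem hres (countable_iInter_mem.mpr fun p => hF p.1 p.2)
  refine (dense_of_mem_residual hcomeager).mono ?_
  rintro x ⟨hxS, hx⟩
  rw [mem_iInter] at hx
  refine ⟨hxS, fun m n hmn => ?_⟩
  by_contra hne
  rcases lt_or_gt_of_ne hne with hlt | hlt
  · exact hx ⟨(m, n), hlt⟩ ⟨hmn.2.1, hmn.2.2⟩
  · exact hx ⟨(n, m), hlt⟩ ⟨hmn.1, hmn.2.2.symm⟩

end dynamics

/-! ### Matrices on `ℓ²(S)` -/

section matrixLemmas

variable {S : Type*}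

lemma inner_e_e [DecidableEq S] (x y : S) : inner ℂ (e x) (e y) = if x = y then (1 : ℂ) else 0 := by
  rw [inner_e, e_apply]
  congr

lemma norm_e (x : S) : ‖e x‖ = 1 := by
  classical
  rw [← sq_eq_sq₀ (norm_nonneg _) zero_le_one, ← inner_self_eq_norm_sq (𝕜 := ℂ), inner_e_e]
  simp

lemma hasSum_e (v : L2 S) : HasSum (fun x => v x • e x) v := by
  classical
  have := lp.hasSum_single (p := 2) (by norm_num) v
  convert this using 2 with x
  rw [e, ← lp.single_smul]
  simp

lemma apply_e_apply (α : Mat S) (x y : S) : α (e y) x = entry α x y := (inner_e _ _).symm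

/-- Taking an entry, as a continuous functional. -/
noncomputable def entryL (x y : S) : Mat S →L[ℂ] ℂ :=
  (innerSL ℂ (e x)).comp (ContinuousLinearMap.apply ℂ (L2 S) (e y))

lemma entryL_apply (x y : S) (α : Mat S) : entryL x y α = entry α x y := rfl

lemma norm_entry_le (x y : S) (α : Mat S) : ‖entry α x y‖ ≤ ‖α‖ := by
  refine (norm_inner_le_norm _ _).trans ?_
  rw [norm_e, one_mul]
  simpa [norm_e] using α.le_opNorm (e y)

@[simp] lemma entry_add (α β : Mat S) (x y : S) :
    entry (α + β) x y = entry α x y + entry β x y := map_add (entryL x y) α β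

@[simp] lemma entry_sub (α β : Mat S) (x y : S) :
    entry (α - β) x y = entry α x y - entry β x y := map_sub (entryL x y) α β

@[simp] lemma entry_smul (c : ℂ) (α : Mat S) (x y : S) :
    entry (c • α) x y = c * entry α x y := map_smul (entryL x y) c α

@[simp] lemma entry_zero (x y : S) : entry (0 : Mat S) x y = 0 := map_zero (entryL x y)

@[simp] lemma entry_sum {ι : Type*} (F : Finset ι) (α : ι → Mat S) (x y : S) :
    entry (∑ i ∈ F, α i) x y = ∑ i ∈ F, entry (α i) x y := map_sum (entryL x y) α F

lemma entry_star (α : Mat S) (x y : S) : entry (star α) x y = star (entry α y x) := by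
  rw [entry, entry, ContinuousLinearMap.star_eq_adjoint, ContinuousLinearMap.adjoint_inner_right,
    ← inner_conj_symm]
  rfl

lemma entry_mul (α β : Mat S) (x y : S) :
    entry (α * β) x y = inner ℂ (star α (e x)) (β (e y)) := by
  rw [ContinuousLinearMap.star_eq_adjoint, ContinuousLinearMap.adjoint_inner_left]
  rfl

lemma ext_e {α β : Mat S} (h : ∀ y, α (e y) = β (e y)) : α = β := by
  ext1 v
  have h1 := (hasSum_e v).mapL α
  have h2 := (hasSum_e v).mapL β
  simp only [map_smul, h] at h1 h2
  exact h1.unique h2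

lemma ext_entry {α β : Mat S} (h : ∀ x y, entry α x y = entry β x y) : α = β :=
  ext_e fun y => by
    ext x
    rw [apply_e_apply, apply_e_apply, h]

lemma IsDiagonal.apply_e {α : Mat S} (h : IsDiagonal α) (y : S) :
    α (e y) = entry α y y • e y := by
  classical
  ext x
  rw [apply_e_apply]
  by_cases hxy : x = y
  · subst hxy
    simp [e_apply]
  · have : entry α x y = 0 := by
      by_contra hne
      exact hxy (h x y hne)
    simp [e_apply, hxy, this]

lemma IsDiagonal.entry_eq_zero {α : Mat S} (h : IsDiagonal α) {x y : S} (hxy : x ≠ y) :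
    entry α x y = 0 := by
  by_contra hne
  exact hxy (h x y hne)

lemma isDiagonal_iff_of_apply_e {α : Mat S} (c : S → ℂ) (h : ∀ y, α (e y) = c y • e y) :
    IsDiagonal α := by
  classical
  intro x y hxy
  by_contra hne
  apply hxy
  rw [← apply_e_apply, h]
  simp [e_apply, hne]

lemma IsDiagonal.mul {α β : Mat S} (hα : IsDiagonal α) (hβ : IsDiagonal β) :
    IsDiagonal (α * β) :=
  isDiagonal_iff_of_apply_e (fun y => entry β y y * entry α y y) fun y => by
    rw [mul_apply_eq_comp, hβ.apply_e, map_smul, hα.apply_e, smul_smul]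

lemma IsDiagonal.star {α : Mat S} (hα : IsDiagonal α) : IsDiagonal (star α) := by
  intro x y h
  rw [entry_star, star_ne_zero] at h
  exact (hα y x h).symm

/-- The diagonal matrices, as a subspace. -/
def diagonals (S : Type*) : Submodule ℂ (Mat S) where
  carrier := {α | IsDiagonal α}
  add_mem' {α β} hα hβ x y h := by
    by_contra hne
    exact h (by rw [entry_add, hα.entry_eq_zero hne, hβ.entry_eq_zero hne, add_zero])
  zero_mem' x y h := absurd (entry_zero x y) h
  smul_mem' c α hα x y h := by
    by_contra hne
    exact h (by rw [entry_smul, hα.entry_eq_zero hne, mul_zero])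

lemma isClosed_diagonals : IsClosed {α : Mat S | IsDiagonal α} := by
  have : {α : Mat S | IsDiagonal α} = ⋂ x, ⋂ y, ⋂ _ : x ≠ y, {α | entryL x y α = 0} := by
    ext α
    simp only [mem_iInter, mem_ofPred_eq, entryL_apply]
    exact ⟨fun h x y hxy => h.entry_eq_zero hxy,
      fun h x y hne => by_contra fun hxy => hne (h x y hxy)⟩
  rw [this]
  exact isClosed_iInter fun x => isClosed_iInter fun y => isClosed_iInter fun _ =>
    isClosed_eq (entryL x y).continuous continuous_const

lemma IsQuasiMonomial.star {α : Mat S} (hα : IsQuasiMonomial α) : IsQuasiMonomial (star α) := by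
  constructor
  · intro x y z h1 h2
    rw [entry_star, star_ne_zero] at h1 h2
    exact hα.2 y z x h1 h2
  · intro x y z h1 h2
    rw [entry_star, star_ne_zero] at h1 h2
    exact hα.1 z x y h1 h2

/-- A quasi-monomial matrix sends every basis vector to a multiple of a basis vector. -/
lemma IsQuasiMonomial.exists_apply_e {α : Mat S} (hα : IsQuasiMonomial α) (y : S) :
    ∃ x, α (e y) = entry α x y • e x := by
  classical
  by_cases h : ∃ x, entry α x y ≠ 0
  · obtain ⟨x, hx⟩ := h
    refine ⟨x, ?_⟩
    ext w
    rw [apply_e_apply]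
    by_cases hwx : w = x
    · subst hwx
      simp [e_apply]
    · have : entry α w y = 0 := by
        by_contra hne
        exact hwx (hα.2 w x y hne hx)
      simp [e_apply, hwx, this]
  · push Not at h
    refine ⟨y, ?_⟩
    ext w
    rw [apply_e_apply, h, h, zero_smul]
    rfl

lemma IsQuasiMonomial.conj_isDiagonal {b α : Mat S} (hb : IsQuasiMonomial b)
    (hα : IsDiagonal α) : IsDiagonal (b * α * Star.star b) := by
  classical
  intro x y hxy
  obtain ⟨z, hz⟩ := hb.star.exists_apply_e x
  obtain ⟨w, hw⟩ := hb.star.exists_apply_e y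
  rw [mul_assoc, entry_mul, mul_apply_eq_comp, hz, hw, map_smul, hα.apply_e] at hxy
  simp only [inner_smul_left, inner_smul_right, inner_e_e, entry_star] at hxy
  by_cases hzw : z = w
  · subst hzw
    refine hb.2 x y z ?_ ?_
    · intro h
      simp [h] at hxy
    · intro h
      simp [h] at hxy
  · simp [hzw] at hxy

lemma inner_sum_e {κ : Type*} (F : Finset κ) (φ : κ → S) (η ξ : κ → ℂ) (T : Mat S) :
    inner ℂ (∑ p ∈ F, η p • e (φ p)) (T (∑ q ∈ F, ξ q • e (φ q))) =
      ∑ p ∈ F, ∑ q ∈ F, star (η p) * ξ q * entry T (φ p) (φ q) := by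
  rw [map_sum, sum_inner]
  refine Finset.sum_congr rfl fun p _ => ?_
  rw [inner_sum]
  refine Finset.sum_congr rfl fun q _ => ?_
  rw [map_smul, inner_smul_left, inner_smul_right, mul_assoc]
  rfl

lemma norm_sq_sum_e {κ : Type*} (F : Finset κ) (φ : κ → S) (hφ : InjOn φ F) (η : κ → ℂ) :
    ‖∑ p ∈ F, η p • e (φ p)‖ ^ 2 = ∑ p ∈ F, ‖η p‖ ^ 2 := by
  classical
  rw [← inner_self_eq_norm_sq (𝕜 := ℂ)]
  have := inner_sum_e F φ η η 1
  rw [one_apply_eq_self] at this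
  rw [this, map_sum]
  refine Finset.sum_congr rfl fun p hp => ?_
  rw [Finset.sum_eq_single p]
  · rw [entry, one_apply_eq_self, inner_e_e, if_pos rfl, mul_one, mul_comm]
    have := RCLike.mul_conj (η p)
    rw [starRingEnd_apply] at this
    rw [this]
    norm_cast
  · intro q hq hqp
    rw [entry, one_apply_eq_self, inner_e_e,
      if_neg fun h => hqp (hφ hp hq h).symm, mul_zero]
  · exact fun h => absurd hp h

/-- A bound on the norm of a matrix bounds the quadratic forms of its finite submatrices. -/
lemma re_sum_le_of_norm_le {T : Mat S} {C : ℝ} (hT : ‖T‖ ≤ C) {κ : Type*} (F : Finset κ)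
    (φ : κ → S) (hφ : InjOn φ F) (η ξ : κ → ℂ) :
    ∑ p ∈ F, ∑ q ∈ F, (star (η p) * ξ q * entry T (φ p) (φ q)).re ≤
      ∑ p ∈ F, C / 2 * (‖η p‖ ^ 2 + ‖ξ p‖ ^ 2) := by
  have h1 := inner_sum_e F φ η ξ T
  have h2 := norm_sq_sum_e F φ hφ η
  have h3 := norm_sq_sum_e F φ hφ ξ
  set u := ∑ p ∈ F, η p • e (φ p)
  set v := ∑ q ∈ F, ξ q • e (φ q)
  have h4 : (inner ℂ u (T v)).re ≤ C / 2 * (‖u‖ ^ 2 + ‖v‖ ^ 2) := by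
    have hC : 0 ≤ C := (norm_nonneg T).trans hT
    have h5 : (inner ℂ u (T v)).re ≤ ‖u‖ * (C * ‖v‖) :=
      (Complex.re_le_norm _).trans ((norm_inner_le_norm _ _).trans
        (mul_le_mul_of_nonneg_left ((T.le_opNorm v).trans
          (mul_le_mul_of_nonneg_right hT (norm_nonneg v))) (norm_nonneg u)))
    nlinarith [mul_nonneg hC (sq_nonneg (‖u‖ - ‖v‖))]
  rw [h1, h2, h3, Complex.re_sum] at h4
  simp only [Complex.re_sum] at h4
  rwa [← Finset.mul_sum, Finset.sum_add_distrib]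

/-- Conversely, a bound on the quadratic forms of the finite submatrices bounds the norm. -/
lemma norm_le_of_re_sum_le {T : Mat S} {C : ℝ} (hC : 0 ≤ C)
    (h : ∀ (F : Finset S) (η ξ : S → ℂ),
      ∑ x ∈ F, ∑ y ∈ F, (star (η x) * ξ y * entry T x y).re ≤
        ∑ x ∈ F, C / 2 * (‖η x‖ ^ 2 + ‖ξ x‖ ^ 2)) : ‖T‖ ≤ C := by
  have key : ∀ u v : L2 S, (inner ℂ u (T v)).re ≤ C / 2 * (‖u‖ ^ 2 + ‖v‖ ^ 2) := by
    intro u v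
    have hu : Filter.Tendsto (fun F : Finset S => ∑ x ∈ F, u x • e x) Filter.atTop (𝓝 u) :=
      hasSum_e u
    have hv : Filter.Tendsto (fun F : Finset S => ∑ x ∈ F, v x • e x) Filter.atTop (𝓝 v) :=
      hasSum_e v
    have h1 : Filter.Tendsto (fun F : Finset S =>
        (inner ℂ (∑ x ∈ F, u x • e x) (T (∑ x ∈ F, v x • e x))).re) Filter.atTop
        (𝓝 (inner ℂ u (T v)).re) :=
      (Complex.continuous_re.tendsto _).comp (hu.inner ((T.continuous.tendsto v).comp hv))
    have h2 : Filter.Tendsto (fun F : Finset S =>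
        C / 2 * (‖∑ x ∈ F, u x • e x‖ ^ 2 + ‖∑ x ∈ F, v x • e x‖ ^ 2)) Filter.atTop
        (𝓝 (C / 2 * (‖u‖ ^ 2 + ‖v‖ ^ 2))) :=
      ((hu.norm.pow 2).add (hv.norm.pow 2)).const_mul _
    refine le_of_tendsto_of_tendsto' h1 h2 fun F => ?_
    have h3 := h F u v
    have h4 := norm_sq_sum_e F id (injOn_id _) u
    have h5 := norm_sq_sum_e F id (injOn_id _) v
    have h6 := inner_sum_e F id u v T
    simp only [id] at h4 h5 h6
    rw [h4, h5, h6, Complex.re_sum]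
    simp only [Complex.re_sum]
    rwa [← Finset.mul_sum, Finset.sum_add_distrib] at h3
  refine T.opNorm_le_bound hC fun v => ?_
  rcases eq_or_ne (T v) 0 with h0 | h0
  · rw [h0, norm_zero]
    positivity
  have hTv : 0 < ‖T v‖ := norm_pos_iff.mpr h0
  have hv : 0 < ‖v‖ := norm_pos_iff.mpr fun h => h0 (by rw [h, map_zero])
  -- Test against the multiple of `T v` that has the norm of `v`.
  have h1 := key (((‖v‖ / ‖T v‖ : ℝ) : ℂ) • T v) v
  have h2 : ‖((‖v‖ / ‖T v‖ : ℝ) : ℂ) • T v‖ = ‖v‖ := by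
    rw [norm_smul, Complex.norm_real, Real.norm_of_nonneg (by positivity)]
    field_simp
  have h3 : (inner ℂ (((‖v‖ / ‖T v‖ : ℝ) : ℂ) • T v) (T v)).re = ‖v‖ * ‖T v‖ := by
    rw [inner_smul_left, Complex.conj_ofReal, Complex.re_ofReal_mul]
    have : (inner ℂ (T v) (T v)).re = ‖T v‖ ^ 2 := inner_self_eq_norm_sq (𝕜 := ℂ) (T v)
    rw [this]
    field_simp
  rw [h2, h3] at h1
  have h4 : ‖v‖ * ‖T v‖ ≤ ‖v‖ * (C * ‖v‖) := by linarith
  exact le_of_mul_le_mul_left h4 hv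

/-- A bound on the diagonal blocks of a form, with respect to the fibres of `c`, bounds its block
diagonal part. -/
lemma sum_ite_class_le {κ τ : Type*} [DecidableEq τ] (F : Finset κ) (c : κ → τ) (g : κ → κ → ℝ)
    (w : κ → ℝ)
    (h : ∀ b ∈ F.image c, ∑ p ∈ F with c p = b, ∑ q ∈ F with c q = b, g p q ≤
      ∑ p ∈ F with c p = b, w p) :
    ∑ p ∈ F, ∑ q ∈ F, (if c p = c q then g p q else 0) ≤ ∑ p ∈ F, w p := by
  have hmaps : ∀ p ∈ F, c p ∈ F.image c := fun p hp => Finset.mem_image_of_mem c hp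
  rw [← Finset.sum_fiberwise_of_maps_to hmaps, ← Finset.sum_fiberwise_of_maps_to hmaps]
  refine Finset.sum_le_sum fun b hb => le_of_eq_of_le ?_ (h b hb)
  refine Finset.sum_congr rfl fun p hp => ?_
  rw [(Finset.mem_filter.mp hp).2, Finset.sum_filter]
  simp only [eq_comm]

end matrixLemmas

/-! ### The algebra spanned by the monomials `a Tᵐ T*ⁿ b` -/

section monomials

variable {X : Type*} [TopologicalSpace X] [CompactSpace X] {N : ℕ} {γ : Fin N → C(X, X)}
  {S : Set X} {σ : X → X}

lemma rhoA_mul (a b : C(X, ℂ)) : rhoA S (a * b) = rhoA S a * rhoA S b :=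
  ext_e fun y => by simp [rhoA_e, mul_apply_eq_comp, smul_smul, mul_comm]

lemma rhoA_one : rhoA S (1 : C(X, ℂ)) = 1 := ext_e fun y => by simp [rhoA_e]

lemma rhoA_smul (c : ℂ) (a : C(X, ℂ)) : rhoA S (c • a) = c • rhoA S a :=
  ext_e fun y => by simp [rhoA_e, smul_smul]

lemma entry_rhoA [DecidableEq S] (a : C(X, ℂ)) (x y : S) :
    entry (rhoA S a) x y = if x = y then a y else 0 := by
  rw [entry, rhoA_e, inner_smul_right, inner_e_e]
  simp

lemma rhoA_star (a : C(X, ℂ)) : star (rhoA S a) = rhoA S (star a) := by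
  classical
  refine ext_entry fun x y => ?_
  rw [entry_star, entry_rhoA, entry_rhoA]
  by_cases h : y = x
  · subst h; simp
  · simp [h, Ne.symm h]

lemma isDiagonal_rhoA (a : C(X, ℂ)) : IsDiagonal (rhoA S a) :=
  isDiagonal_iff_of_apply_e (fun y => a y) fun y => rhoA_e S a y

/-- The extension by zero of a function that is continuous on a clopen set. -/
noncomputable def extendZero {s : Set X} (hs : IsClopen s) (f : X → ℂ) (hf : ContinuousOn f s) :
    C(X, ℂ) where
  toFun := s.indicator f
  continuous_toFun := continuous_indicator (by simp [hs.frontier_eq])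
    (by rwa [hs.isClosed.closure_eq])

variable [T2Space X]

/-- The operator `T`, with `T e_y = ∑ k, e_{γ_k(y)}`. -/
noncomputable def shift (h : IsAdmissible γ S) : Mat S := rhoE h 1

lemma shift_e (h : IsAdmissible γ S) (y : S) : shift h (e y) = ∑ k, e (h.res k y) := by
  simp [shift, rhoE_e]

lemma coe_res (h : IsAdmissible γ S) (k : Fin N) (y : S) : (h.res k y : X) = γ k y := rfl

lemma res_inj (h : IsAdmissible γ S) {j k : Fin N} {x y : S} :
    h.res j x = h.res k y ↔ j = k ∧ x = y := by
  constructor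
  · intro hxy
    have hjk : j = k := by
      by_contra hne
      exact Set.disjoint_left.mp (h.disjoint hne) ⟨_, x.2, rfl⟩
        ⟨_, y.2, (congrArg Subtype.val hxy).symm⟩
    subst hjk
    exact ⟨rfl, h.res_injective _ hxy⟩
  · rintro ⟨rfl, rfl⟩
    rfl

lemma exists_res (h : IsAdmissible γ S) {x : S} (hx : (x : X) ∈ iter γ 1) :
    ∃ k y, h.res k y = x := by
  obtain ⟨k, y, -, hy⟩ := mem_iter_succ.mp hx
  exact ⟨k, ⟨y, (h.completelyInvariant k).2 (by rw [mem_preimage, hy]; exact x.2)⟩,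
    Subtype.ext hy⟩

lemma entry_star_shift [DecidableEq S] (h : IsAdmissible γ S) (z x : S) :
    entry (star (shift h)) z x = ∑ k, if h.res k z = x then 1 else 0 := by
  rw [entry_star, entry, shift_e, inner_sum, star_sum]
  refine Finset.sum_congr rfl fun k _ => ?_
  rw [inner_e_e]
  by_cases hx : h.res k z = x
  · simp [hx]
  · simp [hx, Ne.symm hx]

lemma star_shift_e_res (h : IsAdmissible γ S) (k : Fin N) (y : S) :
    star (shift h) (e (h.res k y)) = e y := by
  classical
  ext z
  rw [apply_e_apply, entry_star_shift, e_apply]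
  simp only [res_inj]
  by_cases hz : z = y <;> simp [hz]

lemma star_shift_e_of_notMem (h : IsAdmissible γ S) {x : S} (hx : (x : X) ∉ iter γ 1) :
    star (shift h) (e x) = 0 := by
  classical
  ext z
  rw [apply_e_apply, entry_star_shift]
  refine Finset.sum_eq_zero fun k _ => if_neg ?_
  rintro rfl
  exact hx (mem_iter_succ.mpr ⟨k, z, mem_iter_zero _, rfl⟩)

/-- The power `T*ⁿ` sends the basis vector of `x` to that of the ancestor `σⁿ(x)`. -/
lemma star_shift_pow_e (h : IsAdmissible γ S) (hσ : ∀ k x, σ (γ k x) = x) {n : ℕ} {x z : S}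
    (hx : (x : X) ∈ iter γ n) (hz : σ^[n] x = z) : (star (shift h) ^ n) (e x) = e z := by
  induction n generalizing x with
  | zero =>
    rw [Subtype.ext (show (x : X) = z from hz), pow_zero, one_apply_eq_self]
  | succ n ih =>
    obtain ⟨k, y, rfl⟩ := exists_res h (mem_iter_of_le hσ (Nat.le_add_left 1 n) hx)
    rw [pow_succ, mul_apply_eq_comp, star_shift_e_res]
    rw [coe_res, apply_mem_iter_succ hσ] at hx
    rw [coe_res, Function.iterate_succ_apply, hσ] at hz
    exact ih hx hz

lemma star_shift_pow_e_of_notMem (h : IsAdmissible γ S) (hσ : ∀ k x, σ (γ k x) = x) {n : ℕ}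
    {x : S} (hx : (x : X) ∉ iter γ n) : (star (shift h) ^ n) (e x) = 0 := by
  induction n generalizing x with
  | zero => exact absurd (mem_iter_zero _) hx
  | succ n ih =>
    rw [pow_succ, mul_apply_eq_comp]
    by_cases h1 : (x : X) ∈ iter γ 1
    · obtain ⟨k, y, rfl⟩ := exists_res h h1
      rw [star_shift_e_res]
      rw [coe_res, apply_mem_iter_succ hσ] at hx
      exact ih hx
    · rw [star_shift_e_of_notMem h h1, map_zero]

/-- The monomial `a Tᵐ T*ⁿ b`. -/
noncomputable def mono (h : IsAdmissible γ S) (a : C(X, ℂ)) (m n : ℕ) (b : C(X, ℂ)) : Mat S :=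
  rhoA S a * shift h ^ m * star (shift h) ^ n * rhoA S b

open Classical in
lemma entry_mono (h : IsAdmissible γ S) (hσ : ∀ k x, σ (γ k x) = x) (a b : C(X, ℂ)) (m n : ℕ)
    (x y : S) :
    entry (mono h a m n b) x y = if Meets γ σ m n (x : X) y then a x * b y else 0 := by
  have h1 : entry (mono h a m n b) x y =
      a x * b y * inner ℂ ((star (shift h) ^ m) (e x)) ((star (shift h) ^ n) (e y)) := by
    rw [mono, mul_assoc, entry_mul, star_mul, star_pow, rhoA_star, mul_apply_eq_comp,
      mul_apply_eq_comp, rhoA_e, rhoA_e, map_smul, map_smul, inner_smul_left, inner_smul_right]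
    simp [mul_assoc]
  rw [h1]
  by_cases hx : (x : X) ∈ iter γ m
  · by_cases hy : (y : X) ∈ iter γ n
    · rw [star_shift_pow_e h hσ hx (z := ⟨_, sigma_iter_mem h hσ x.2 hx⟩) rfl,
        star_shift_pow_e h hσ hy (z := ⟨_, sigma_iter_mem h hσ y.2 hy⟩) rfl, inner_e_e]
      simp [Meets, hx, hy]
    · rw [star_shift_pow_e_of_notMem h hσ hy]
      simp [Meets, hy]
  · rw [star_shift_pow_e_of_notMem h hσ hx]
    simp [Meets, hx]

lemma star_mono (h : IsAdmissible γ S) (a b : C(X, ℂ)) (m n : ℕ) :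
    star (mono h a m n b) = mono h (star b) n m (star a) := by
  simp [mono, star_mul, star_pow, rhoA_star, mul_assoc]

lemma mono_zero_zero (h : IsAdmissible γ S) (a : C(X, ℂ)) : mono h a 0 0 1 = rhoA S a := by
  simp [mono, rhoA_one]

lemma smul_mono (h : IsAdmissible γ S) (c : ℂ) (a b : C(X, ℂ)) (m n : ℕ) :
    c • mono h a m n b = mono h (c • a) m n b := by
  simp [mono, rhoA_smul]

/-- The transfer operator `a ↦ ∑ k, a ∘ γ_k`. -/
noncomputable def transfer (γ : Fin N → C(X, X)) (a : C(X, ℂ)) : C(X, ℂ) := ∑ k, a.comp (γ k)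

/-- The endomorphism `a ↦ a ∘ σ` of `C(X)`, where `a ∘ σ` is extended by zero off `γ(X)`. -/
noncomputable def endo (hc : ContinuousOn σ (ifsImage γ univ)) (hcl : IsClopen (iter γ 1))
    (a : C(X, ℂ)) : C(X, ℂ) :=
  extendZero hcl (a ∘ σ) (a.continuous.comp_continuousOn hc)

lemma endo_apply (hσ : ∀ k x, σ (γ k x) = x) (hc : ContinuousOn σ (ifsImage γ univ))
    (hcl : IsClopen (iter γ 1)) (a : C(X, ℂ)) (k : Fin N) (x : X) :
    endo hc hcl a (γ k x) = a x := by
  change (iter γ 1).indicator (a ∘ σ) (γ k x) = a x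
  rw [indicator_of_mem ((apply_mem_iter_succ hσ).mpr (mem_iter_zero x)), Function.comp_apply, hσ]

lemma star_shift_mul_rhoA_mul_shift (h : IsAdmissible γ S) (a : C(X, ℂ)) :
    star (shift h) * rhoA S a * shift h = rhoA S (transfer γ a) :=
  ext_e fun y => by
    rw [mul_apply_eq_comp, mul_apply_eq_comp, shift_e, map_sum, map_sum, rhoA_e, transfer,
      ContinuousMap.sum_apply, Finset.sum_smul]
    refine Finset.sum_congr rfl fun k _ => ?_
    rw [rhoA_e, map_smul, star_shift_e_res]
    rfl

lemma star_shift_pow_mul_rhoA_mul_shift_pow (h : IsAdmissible γ S) (a : C(X, ℂ)) (n : ℕ) :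
    star (shift h) ^ n * rhoA S a * shift h ^ n = rhoA S ((transfer γ)^[n] a) := by
  induction n generalizing a with
  | zero => simp
  | succ n ih =>
    rw [Function.iterate_succ_apply, ← ih, ← star_shift_mul_rhoA_mul_shift h, pow_succ,
      pow_succ']
    simp only [mul_assoc]

lemma shift_mul_rhoA (h : IsAdmissible γ S) (hσ : ∀ k x, σ (γ k x) = x)
    (hc : ContinuousOn σ (ifsImage γ univ)) (hcl : IsClopen (iter γ 1)) (a : C(X, ℂ)) :
    shift h * rhoA S a = rhoA S (endo hc hcl a) * shift h :=
  ext_e fun y => by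
    rw [mul_apply_eq_comp, mul_apply_eq_comp, rhoA_e, map_smul, shift_e, map_sum,
      Finset.smul_sum]
    refine Finset.sum_congr rfl fun k _ => ?_
    rw [rhoA_e, coe_res, endo_apply hσ]

lemma shift_pow_mul_rhoA (h : IsAdmissible γ S) (hσ : ∀ k x, σ (γ k x) = x)
    (hc : ContinuousOn σ (ifsImage γ univ)) (hcl : IsClopen (iter γ 1)) (a : C(X, ℂ)) (n : ℕ) :
    shift h ^ n * rhoA S a = rhoA S ((endo hc hcl)^[n] a) * shift h ^ n := by
  induction n generalizing a with
  | zero => simp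
  | succ n ih =>
    rw [Function.iterate_succ_apply, pow_succ, mul_assoc, shift_mul_rhoA h hσ hc hcl,
      ← mul_assoc, ih, mul_assoc]

/-- The product of two monomials of degrees `k` and `l` is a monomial of degree `k + l`. -/
lemma exists_mono_mul_mono (h : IsAdmissible γ S) (hσ : ∀ k x, σ (γ k x) = x)
    (hc : ContinuousOn σ (ifsImage γ univ)) (hcl : IsClopen (iter γ 1)) (a b a' b' : C(X, ℂ))
    (m n m' n' : ℕ) : ∃ (a'' b'' : C(X, ℂ)) (m'' n'' : ℕ),
      mono h a m n b * mono h a' m' n' b' = mono h a'' m'' n'' b'' ∧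
      (m'' : ℤ) - n'' = (m - n) + (m' - n') := by
  -- If `n ≤ m'`, then `T*ⁿ` is absorbed by `T^m'`; the other case follows by taking adjoints.
  wlog hle : n ≤ m' generalizing a b a' b' m n m' n'
  · obtain ⟨a'', b'', m'', n'', h1, h2⟩ :=
      this (star b') (star a') (star b) (star a) n' m' n m (by omega)
    refine ⟨star b'', star a'', n'', m'', ?_, by omega⟩
    rw [← star_mono, ← h1, star_mul, star_mono, star_mono]
    simp
  obtain ⟨d, rfl⟩ := Nat.exists_eq_add_of_le hle
  refine ⟨a * (endo hc hcl)^[m] ((transfer γ)^[n] (b * a')), b', m + d, n', ?_, ?_⟩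
  · calc mono h a m n b * mono h a' (n + d) n' b'
        = rhoA S a * (shift h ^ m * (star (shift h) ^ n * rhoA S (b * a') * shift h ^ n)) *
            shift h ^ d * star (shift h) ^ n' * rhoA S b' := by
          simp only [mono, rhoA_mul, pow_add, mul_assoc]
      _ = _ := by
          rw [star_shift_pow_mul_rhoA_mul_shift_pow, shift_pow_mul_rhoA h hσ hc hcl]
          simp only [mono, rhoA_mul, pow_add, mul_assoc]
  · push_cast
    ring

/-- Every `ρ_E(f)` is a monomial `a T`. -/
lemma exists_rhoE_eq (h : IsAdmissible γ S) (hσ : ∀ k x, σ (γ k x) = x)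
    (hc : ContinuousOn σ (ifsImage γ univ)) (hcl : IsClopen (iter γ 1)) (f : C(graph γ, ℂ)) :
    ∃ a : C(X, ℂ), rhoE h f = rhoA S a * shift h := by
  obtain ⟨g, hg⟩ := ContinuousMap.exists_restrict_eq (isClosed_graph γ) f
  refine ⟨extendZero hcl (fun x => g (x, σ x))
    (g.continuous.comp_continuousOn (continuousOn_id.prodMk hc)), ext_e fun y => ?_⟩
  rw [rhoE_e, mul_apply_eq_comp, shift_e, map_sum]
  refine Finset.sum_congr rfl fun k _ => ?_
  rw [rhoA_e]
  congr 1
  change f (graphPt γ k y) = (iter γ 1).indicator (fun x => g (x, σ x)) (γ k y)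
  rw [indicator_of_mem ((apply_mem_iter_succ hσ).mpr (mem_iter_zero _)), hσ, ← hg]
  rfl

end monomials

/-! ### The graded subspaces `B_k` and the generated C*-algebras -/

section grading

variable {X : Type*} [TopologicalSpace X] [CompactSpace X] [T2Space X] {N : ℕ}
  {γ : Fin N → C(X, X)} {S : Set X} {σ : X → X}

lemma exists_bump {z : X} {F : Set X} (hF : IsClosed F) (hz : z ∉ F) :
    ∃ a : C(X, ℂ), a z = 1 ∧ (∀ x ∈ F, a x = 0) ∧ ∀ x, ‖a x‖ ≤ 1 := by
  obtain ⟨f, h0, h1, h01⟩ := exists_continuous_zero_one_of_isClosed hF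
    (isClosed_singleton (x := z)) (disjoint_singleton_right.mpr hz)
  refine ⟨⟨fun x => (f x : ℂ), by fun_prop⟩, ?_, fun x hx => ?_, fun x => ?_⟩
  · simp [h1 (mem_singleton z)]
  · simp [h0 hx]
  · simp only [ContinuousMap.coe_mk, Complex.norm_real, Real.norm_of_nonneg (h01 x).1]
    exact (h01 x).2

lemma norm_mulOp_le {Y : Type*} [TopologicalSpace Y] [CompactSpace Y] (a : C(Y, ℂ)) (τ : S → Y) :
    ‖mulOp a τ‖ ≤ ‖a‖ := by
  unfold mulOp compOp
  exact LinearMap.mkContinuous_norm_le _ (norm_nonneg a) _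

/-- `mulOp` as a continuous linear map in the function. -/
noncomputable def mulOpL {Y : Type*} [TopologicalSpace Y] [CompactSpace Y] (τ : S → Y) :
    C(Y, ℂ) →L[ℂ] Mat S :=
  LinearMap.mkContinuous
    { toFun := fun a => mulOp a τ
      map_add' := fun a b => ext_e fun y => by simp [mulOp_e, add_smul]
      map_smul' := fun c a => ext_e fun y => by simp [mulOp_e, smul_smul] }
    1 fun a => by simpa using norm_mulOp_le a τ

/-- `ρ_{m,n}` as a continuous linear map. -/
noncomputable def rhoMNL (h : IsAdmissible γ S) (m n : ℕ) : C(bichains γ m n, ℂ) →L[ℂ] Mat S :=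
  ∑ k : Fin n → Fin N, ∑ j : Fin m → Fin N,
    (ContinuousLinearMap.mul ℂ (Mat S) (push (h.resWord j) (h.resWord_injective j))).comp
      (((ContinuousLinearMap.mul ℂ (Mat S)).flip
        (pull (h.resWord k) (h.resWord_injective k))).comp
        (mulOpL fun x : S => bichainPt γ j k x))

lemma rhoMNL_apply (h : IsAdmissible γ S) (m n : ℕ) (f : C(bichains γ m n, ℂ)) :
    rhoMNL h m n f = rhoMN h m n f := by
  simp only [rhoMNL, rhoMN, _root_.sum_apply, mul_assoc]
  rfl

/-- The end point of the first chain of a bichain. -/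
def ends₁ (γ : Fin N → C(X, X)) (m n : ℕ) : C(bichains γ m n, X) where
  toFun p := p.1.1 (Fin.last m)
  continuous_toFun := by fun_prop

/-- The end point of the second chain of a bichain. -/
def ends₂ (γ : Fin N → C(X, X)) (m n : ℕ) : C(bichains γ m n, X) where
  toFun p := p.1.2 (Fin.last n)
  continuous_toFun := by fun_prop

lemma coe_resWord (h : IsAdmissible γ S) {n : ℕ} (k : Fin n → Fin N) (x : S) :
    (h.resWord k x : X) = word (fun i => γ i) k x := rfl

lemma resWord_inj (h : IsAdmissible γ S) {n : ℕ} {j k : Fin n → Fin N} {x : S}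
    (hjk : h.resWord j x = h.resWord k x) : j = k :=
  funext fun r => orbit_word_inj h j k x.2 x.2 (Fin.last n) (congrArg Subtype.val hjk) r
    (Fin.castSucc_lt_last r)

/-- On functions of the end points of a bichain, `ρ_{m,n}` is a monomial. -/
lemma rhoMN_tensor (h : IsAdmissible γ S) (hσ : ∀ k x, σ (γ k x) = x) (m n : ℕ) (a b : C(X, ℂ)) :
    rhoMN h m n (a.comp (ends₁ γ m n) * b.comp (ends₂ γ m n)) = mono h a m n b := by
  classical
  refine ext_entry fun x y => ?_
  rw [entry_mono h hσ]
  by_cases hy : (y : X) ∈ iter γ n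
  · obtain ⟨k, hk⟩ := exists_word_iff hσ |>.mpr ⟨hy, rfl⟩
    obtain ⟨z, hz⟩ : ∃ z : S, (z : X) = σ^[n] y := ⟨⟨_, sigma_iter_mem h hσ y.2 hy⟩, rfl⟩
    rw [← hz] at hk
    obtain rfl : h.resWord k z = y := Subtype.ext hk
    rw [entry, rhoMN_e, inner_sum]
    have hterm : ∀ j : Fin m → Fin N,
        inner ℂ (e x) ((a.comp (ends₁ γ m n) * b.comp (ends₂ γ m n)) (bichainPt γ j k z) •
          e (h.resWord j z)) = if h.resWord j z = x then a x * b (h.resWord k z) else 0 := by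
      intro j
      rw [inner_smul_right, inner_e_e]
      by_cases hj : h.resWord j z = x
      · subst hj
        simp only [if_true, mul_one]
        rfl
      · rw [if_neg (Ne.symm hj), if_neg hj, mul_zero]
    rw [Finset.sum_congr rfl fun j _ => hterm j]
    have hiff : Meets γ σ m n (x : X) (h.resWord k z) ↔
        ∃ j : Fin m → Fin N, h.resWord j z = x := by
      simp only [Meets, ← hz, hy, true_and]
      rw [← exists_word_iff hσ]
      simp only [Subtype.ext_iff, coe_resWord]
    by_cases hm : Meets γ σ m n (x : X) (h.resWord k z)
    · rw [if_pos hm]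
      obtain ⟨j, hj⟩ := hiff.mp hm
      rw [Finset.sum_eq_single j, if_pos hj]
      · intro j' _ hj'
        exact if_neg fun heq => hj' (resWord_inj h (heq.trans hj.symm))
      · simp
    · rw [if_neg hm]
      exact Finset.sum_eq_zero fun j _ => if_neg fun hj => hm (hiff.mpr ⟨j, hj⟩)
  · rw [if_neg fun hm => hy hm.2.1, entry, rhoMN_e_of_notMem, inner_zero_right]
    rintro k ⟨z, rfl⟩
    exact hy (exists_word_iff hσ |>.mp ⟨k, rfl⟩).1

/-- The end point of a chain determines the chain, because `σ` inverts every map of the system. -/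
lemma chain_ext (hσ : ∀ k x, σ (γ k x) = x) {n : ℕ} {c d : Fin (n + 1) → X}
    (hc : c ∈ chains γ n) (hd : d ∈ chains γ n) (h : c (Fin.last n) = d (Fin.last n)) : c = d := by
  funext i
  induction i using Fin.reverseInduction with
  | last => exact h
  | cast i ih =>
    obtain ⟨j, hj⟩ := hc i
    obtain ⟨k, hk⟩ := hd i
    rw [hj, hk] at ih
    simpa [hσ] using congrArg σ ih

open TensorProduct in
/-- By the Stone–Weierstrass theorem, functions of the two end points of a bichain suffice. -/
lemma mem_closure_span_tensor (hσ : ∀ k x, σ (γ k x) = x) (m n : ℕ) (f : C(bichains γ m n, ℂ)) :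
    f ∈ (Submodule.span ℂ (range fun p : C(X, ℂ) × C(X, ℂ) =>
      p.1.comp (ends₁ γ m n) * p.2.comp (ends₂ γ m n))).topologicalClosure := by
  set V := Submodule.span ℂ (range fun p : C(X, ℂ) × C(X, ℂ) =>
      p.1.comp (ends₁ γ m n) * p.2.comp (ends₂ γ m n)) with hV
  have hmul : ∀ x ∈ V, ∀ y ∈ V, x * y ∈ V := by
    intro x hx y hy
    induction hx, hy using Submodule.span_induction₂ with
    | mem_mem x y hx hy =>
      obtain ⟨p, rfl⟩ := hx
      obtain ⟨q, rfl⟩ := hy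
      refine Submodule.subset_span ⟨(p.1 * q.1, p.2 * q.2), ?_⟩
      ext z
      simp only [ContinuousMap.mul_apply, ContinuousMap.comp_apply]
      ring
    | zero_left y hy => simp
    | zero_right x hx => simp
    | add_left x y z _ _ _ h1 h2 => rw [add_mul]; exact add_mem h1 h2
    | add_right x y z _ _ _ h1 h2 => rw [mul_add]; exact add_mem h1 h2
    | smul_left r x y _ _ h => rw [smul_mul_assoc]; exact V.smul_mem r h
    | smul_right r x y _ _ h => rw [mul_smul_comm]; exact V.smul_mem r h
  have hone : (1 : C(bichains γ m n, ℂ)) ∈ V :=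
    Submodule.subset_span ⟨(1, 1), by ext z; simp⟩
  have hstar : ∀ x ∈ V, star x ∈ V := by
    intro x hx
    induction hx using Submodule.span_induction with
    | mem x hx =>
      obtain ⟨p, rfl⟩ := hx
      exact Submodule.subset_span ⟨(star p.1, star p.2), by ext z; simp⟩
    | zero => simp
    | add x y _ _ h1 h2 => rw [star_add]; exact add_mem h1 h2
    | smul r x _ h => rw [star_smul]; exact V.smul_mem _ h
  let A : StarSubalgebra ℂ C(bichains γ m n, ℂ) :=
    { V.toSubalgebra hone (fun x y hx hy => hmul x hx y hy) with
      star_mem' := fun {x} hx => hstar x hx }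
  have hsep : A.SeparatesPoints := by
    intro p q hpq
    by_contra hcon
    push Not at hcon
    have hA : ∀ g ∈ V, g p = g q := fun g hg => hcon g ⟨g, hg, rfl⟩
    have h1 : ends₁ γ m n p = ends₁ γ m n q := by
      by_contra hne
      obtain ⟨g, hg1, hg0, -⟩ := exists_bump isClosed_singleton (notMem_singleton_iff.mpr hne)
      have h0 := hA _ (Submodule.subset_span ⟨(g, 1), rfl⟩)
      simp [hg1, hg0 _ (mem_singleton _)] at h0
    have h2 : ends₂ γ m n p = ends₂ γ m n q := by
      by_contra hne
      obtain ⟨g, hg1, hg0, -⟩ := exists_bump isClosed_singleton (notMem_singleton_iff.mpr hne)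
      have h0 := hA _ (Submodule.subset_span ⟨(1, g), rfl⟩)
      simp [hg1, hg0 _ (mem_singleton _)] at h0
    exact hpq (Subtype.ext (Prod.ext (chain_ext hσ p.2.1 q.2.1 h1)
      (chain_ext hσ p.2.2.1 q.2.2.1 h2)))
  have htop := ContinuousMap.starSubalgebra_topologicalClosure_eq_top_of_separatesPoints A hsep
  have : f ∈ A.topologicalClosure := htop ▸ StarSubalgebra.mem_top
  exact this

/-- The span of the monomials of degree `k`. -/
noncomputable def monoSpan (h : IsAdmissible γ S) (k : ℤ) : Submodule ℂ (Mat S) :=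
  Submodule.span ℂ
    {α | ∃ (a : C(X, ℂ)) (m n : ℕ) (b : C(X, ℂ)), (m : ℤ) - n = k ∧ α = mono h a m n b}

lemma mono_mem_monoSpan (h : IsAdmissible γ S) (a b : C(X, ℂ)) {m n : ℕ} {k : ℤ}
    (hk : (m : ℤ) - n = k) : mono h a m n b ∈ monoSpan h k :=
  Submodule.subset_span ⟨a, m, n, b, hk, rfl⟩

lemma B_eq (h : IsAdmissible γ S) (hσ : ∀ k x, σ (γ k x) = x) (k : ℤ) :
    B h k = (monoSpan h k).topologicalClosure := by
  apply le_antisymm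
  · refine Submodule.topologicalClosure_minimal _ ?_
      (Submodule.isClosed_topologicalClosure _)
    rw [Submodule.span_le]
    rintro _ ⟨m, n, hk, f, rfl⟩
    rw [← rhoMNL_apply]
    refine map_mem_closure (rhoMNL h m n).continuous (mem_closure_span_tensor hσ m n f) ?_
    intro g hg
    induction hg using Submodule.span_induction with
    | mem g hg =>
      obtain ⟨p, rfl⟩ := hg
      rw [rhoMNL_apply, rhoMN_tensor h hσ]
      exact mono_mem_monoSpan h _ _ hk
    | zero => rw [map_zero]; exact zero_mem _
    | add x y _ _ h1 h2 => rw [map_add]; exact add_mem h1 h2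
    | smul r x _ h => rw [map_smul]; exact Submodule.smul_mem _ r h
  · refine Submodule.topologicalClosure_mono (Submodule.span_mono ?_)
    rintro _ ⟨a, m, n, b, hk, rfl⟩
    exact ⟨m, n, hk, _, rhoMN_tensor h hσ m n a b⟩

lemma mono_mem_B (h : IsAdmissible γ S) (hσ : ∀ k x, σ (γ k x) = x) (a b : C(X, ℂ)) {m n : ℕ}
    {k : ℤ} (hk : (m : ℤ) - n = k) : mono h a m n b ∈ B h k := by
  rw [B_eq h hσ]
  exact Submodule.le_topologicalClosure _ (mono_mem_monoSpan h a b hk)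

lemma monoSpan_mul (h : IsAdmissible γ S) (hσ : ∀ k x, σ (γ k x) = x)
    (hc : ContinuousOn σ (ifsImage γ univ)) (hcl : IsClopen (iter γ 1)) {k l : ℤ} {α β : Mat S}
    (hα : α ∈ monoSpan h k) (hβ : β ∈ monoSpan h l) : α * β ∈ monoSpan h (k + l) := by
  induction hα, hβ using Submodule.span_induction₂ with
  | mem_mem x y hx hy =>
    obtain ⟨a, m, n, b, hk, rfl⟩ := hx
    obtain ⟨a', m', n', b', hl, rfl⟩ := hy
    obtain ⟨a'', b'', m'', n'', h1, h2⟩ := exists_mono_mul_mono h hσ hc hcl a b a' b' m n m' n'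
    rw [h1]
    exact mono_mem_monoSpan h _ _ (by omega)
  | zero_left y hy => simp
  | zero_right x hx => simp
  | add_left x y z _ _ _ h1 h2 => rw [add_mul]; exact add_mem h1 h2
  | add_right x y z _ _ _ h1 h2 => rw [mul_add]; exact add_mem h1 h2
  | smul_left r x y _ _ h => rw [smul_mul_assoc]; exact Submodule.smul_mem _ r h
  | smul_right r x y _ _ h => rw [mul_smul_comm]; exact Submodule.smul_mem _ r h

lemma monoSpan_star (h : IsAdmissible γ S) {k : ℤ} {α : Mat S} (hα : α ∈ monoSpan h k) :
    star α ∈ monoSpan h (-k) := by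
  induction hα using Submodule.span_induction with
  | mem x hx =>
    obtain ⟨a, m, n, b, hk, rfl⟩ := hx
    rw [star_mono]
    exact mono_mem_monoSpan h _ _ (by omega)
  | zero => simp
  | add x y _ _ h1 h2 => rw [star_add]; exact add_mem h1 h2
  | smul r x _ h => rw [star_smul]; exact Submodule.smul_mem _ _ h

lemma B_mul (h : IsAdmissible γ S) (hσ : ∀ k x, σ (γ k x) = x)
    (hc : ContinuousOn σ (ifsImage γ univ)) (hcl : IsClopen (iter γ 1)) {k l : ℤ} {α β : Mat S}
    (hα : α ∈ B h k) (hβ : β ∈ B h l) : α * β ∈ B h (k + l) := by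
  rw [B_eq h hσ] at *
  exact map_mem_closure₂ continuous_mul hα hβ fun x hx y hy => monoSpan_mul h hσ hc hcl hx hy

lemma B_star (h : IsAdmissible γ S) (hσ : ∀ k x, σ (γ k x) = x) {k : ℤ} {α : Mat S}
    (hα : α ∈ B h k) : star α ∈ B h (-k) := by
  rw [B_eq h hσ] at *
  exact map_mem_closure continuous_star hα fun x hx => monoSpan_star h hx

section spans

variable {M : Type*} [CStarAlgebra M]

/-- The linear span of a set whose products and adjoints lie in the span, as a `*`-subalgebra. -/
noncomputable def spanSubalgebra (G : Set M)
    (hmul : ∀ x ∈ G, ∀ y ∈ G, x * y ∈ Submodule.span ℂ G)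
    (hstar : ∀ x ∈ G, star x ∈ Submodule.span ℂ G) : NonUnitalStarSubalgebra ℂ M :=
  { Submodule.span ℂ G with
    mul_mem' := fun {x y} hx hy => by
      change x * y ∈ Submodule.span ℂ G
      induction hx, hy using Submodule.span_induction₂ with
      | mem_mem x y hx hy => exact hmul x hx y hy
      | zero_left y hy => simp
      | zero_right x hx => simp
      | add_left x y z _ _ _ h1 h2 => rw [add_mul]; exact add_mem h1 h2
      | add_right x y z _ _ _ h1 h2 => rw [mul_add]; exact add_mem h1 h2
      | smul_left r x y _ _ h => rw [smul_mul_assoc]; exact Submodule.smul_mem _ r h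
      | smul_right r x y _ _ h => rw [mul_smul_comm]; exact Submodule.smul_mem _ r h
    star_mem' := fun {x} hx => by
      change star x ∈ Submodule.span ℂ G
      change x ∈ Submodule.span ℂ G at hx
      induction hx using Submodule.span_induction with
      | mem x hx => exact hstar x hx
      | zero => simp
      | add x y _ _ h1 h2 => rw [star_add]; exact add_mem h1 h2
      | smul r x _ h => rw [star_smul]; exact Submodule.smul_mem _ _ h }

lemma cstarGen_subset_closure_span {s G : Set M}
    (hmul : ∀ x ∈ G, ∀ y ∈ G, x * y ∈ Submodule.span ℂ G)
    (hstar : ∀ x ∈ G, star x ∈ Submodule.span ℂ G) (hs : s ⊆ Submodule.span ℂ G) :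
    (cstarGen s : Set M) ⊆ closure (Submodule.span ℂ G : Set M) :=
  closure_mono (NonUnitalStarAlgebra.adjoin_le (S := spanSubalgebra G hmul hstar) hs)

lemma subset_cstarGen (s : Set M) : s ⊆ cstarGen s :=
  (NonUnitalStarAlgebra.subset_adjoin ℂ s).trans subset_closure

lemma isClosed_cstarGen (s : Set M) : IsClosed (cstarGen s : Set M) := isClosed_closure

lemma cstarGen_subset {s : Set M} {A : NonUnitalStarSubalgebra ℂ M} (hA : IsClosed (A : Set M))
    (hs : s ⊆ A) : (cstarGen s : Set M) ⊆ A :=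
  closure_minimal (NonUnitalStarAlgebra.adjoin_le hs) hA

end spans

section rho

variable (h : IsAdmissible γ S)

lemma rhoA_mem (a : C(X, ℂ)) : rhoA S a ∈ cstarRho h := subset_cstarGen _ (Or.inl ⟨a, rfl⟩)

lemma rhoE_mem (f : C(graph γ, ℂ)) : rhoE h f ∈ cstarRho h := subset_cstarGen _ (Or.inr ⟨f, rfl⟩)

lemma rhoA_mul_shift_pow_mem (a : C(X, ℂ)) (m : ℕ) : rhoA S a * shift h ^ m ∈ cstarRho h := by
  induction m with
  | zero => simpa using rhoA_mem h a
  | succ m ih =>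
    rw [pow_succ, ← mul_assoc]
    exact mul_mem (S := NonUnitalStarSubalgebra ℂ (Mat S)) ih (rhoE_mem h 1)

lemma mono_mem_cstarRho (a b : C(X, ℂ)) (m n : ℕ) : mono h a m n b ∈ cstarRho h := by
  have h1 := star_mem (S := NonUnitalStarSubalgebra ℂ (Mat S)) (rhoA_mul_shift_pow_mem h (star b) n)
  have h2 := mul_mem (S := NonUnitalStarSubalgebra ℂ (Mat S)) (rhoA_mul_shift_pow_mem h a m) h1
  rw [star_mul, star_pow, rhoA_star, star_star] at h2
  rw [mono, mul_assoc]
  exact h2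

lemma monoSpan_subset (k : ℤ) : (monoSpan h k : Set (Mat S)) ⊆ cstarRho h := by
  change monoSpan h k ≤ (cstarGen _).toSubmodule
  refine Submodule.span_le.mpr ?_
  rintro _ ⟨a, m, n, b, -, rfl⟩
  exact mono_mem_cstarRho h a b m n

lemma B_subset (hσ : ∀ k x, σ (γ k x) = x) (k : ℤ) : (B h k : Set (Mat S)) ⊆ cstarRho h := by
  rw [B_eq h hσ]
  exact closure_minimal (monoSpan_subset h k) (isClosed_cstarGen _)

/-- The set of all monomials. -/
def monos : Set (Mat S) := {α | ∃ (a : C(X, ℂ)) (m n : ℕ) (b : C(X, ℂ)), α = mono h a m n b}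

lemma cstarRho_subset (hσ : ∀ k x, σ (γ k x) = x) (hc : ContinuousOn σ (ifsImage γ univ))
    (hcl : IsClopen (iter γ 1)) :
    cstarRho h ⊆ closure (Submodule.span ℂ (monos h) : Set (Mat S)) := by
  refine cstarGen_subset_closure_span ?_ ?_ ?_
  · rintro _ ⟨a, m, n, b, rfl⟩ _ ⟨a', m', n', b', rfl⟩
    obtain ⟨a'', b'', m'', n'', h1, -⟩ := exists_mono_mul_mono h hσ hc hcl a b a' b' m n m' n'
    exact Submodule.subset_span ⟨a'', m'', n'', b'', h1⟩
  · rintro _ ⟨a, m, n, b, rfl⟩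
    exact Submodule.subset_span ⟨_, _, _, _, star_mono h a b m n⟩
  · rintro _ (⟨a, rfl⟩ | ⟨f, rfl⟩)
    · exact Submodule.subset_span ⟨a, 0, 0, 1, (mono_zero_zero h a).symm⟩
    · obtain ⟨a, ha⟩ := exists_rhoE_eq h hσ hc hcl f
      exact Submodule.subset_span ⟨a, 1, 0, 1, by simp [mono, ha, rhoA_one]⟩

/-- Diagonal matrices of degree `0` form a C*-algebra. -/
lemma isCStarSubalgebra_D (hσ : ∀ k x, σ (γ k x) = x) (hc : ContinuousOn σ (ifsImage γ univ))
    (hcl : IsClopen (iter γ 1)) : IsCStarSubalgebra (D h 0) (cstarRho h) := by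
  refine ⟨fun α hα => B_subset h hσ 0 hα.1,
    { B h 0 ⊓ diagonals S with
      mul_mem' := fun {x y} hx hy => ⟨by simpa using B_mul h hσ hc hcl hx.1 hy.1, hx.2.mul hy.2⟩
      star_mem' := fun {x} hx => ⟨by simpa using B_star h hσ hx.1, hx.2.star⟩ }, rfl, ?_⟩
  exact (Submodule.isClosed_topologicalClosure _).inter isClosed_diagonals

end rho

end grading

/-! ### Diagonal elements of `C*(ρ)` have degree zero -/

section kernel

variable {X : Type*} [TopologicalSpace X] [CompactSpace X] [T2Space X] {N : ℕ}
  {γ : Fin N → C(X, X)} {S : Set X} {σ : X → X}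

/-- The action of a word on the points of `S`. -/
def wdS (h : IsAdmissible γ S) (l : List (Fin N)) (z : S) : S := ⟨wd γ l z, wd_mem h l z.2⟩

open Classical in
/-- The kernel on words that a sum of monomials `a t T^(m t) T*^(n t) b t` acts by along the forward
orbit of `z`. In contrast to the matrix entries themselves it is continuous in `z`. -/
noncomputable def wordKernel {ι : Type*} (Q : Finset ι) (a b : ι → C(X, ℂ)) (m n : ι → ℕ)
    (γ : Fin N → C(X, X)) (k l : List (Fin N)) (z : X) : ℂ :=
  ∑ t ∈ Q, if m t ≤ k.length ∧ n t ≤ l.length ∧ k.drop (m t) = l.drop (n t) then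
    a t (wd γ k z) * b t (wd γ l z) else 0

lemma continuous_wordKernel {ι : Type*} (Q : Finset ι) (a b : ι → C(X, ℂ)) (m n : ι → ℕ)
    (k l : List (Fin N)) : Continuous (wordKernel Q a b m n γ k l) := by
  refine continuous_finsetSum Q fun t _ => ?_
  split_ifs
  · exact ((a t).continuous.comp (continuous_wd k)).mul ((b t).continuous.comp (continuous_wd l))
  · exact continuous_const

lemma wd_mem_iter_iff (hσ : ∀ k x, σ (γ k x) = x) {l : List (Fin N)} {z : X} {m : ℕ}
    (hl : z ∉ iter γ 1 ∨ m ≤ l.length) : wd γ l z ∈ iter γ m ↔ m ≤ l.length := by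
  refine ⟨fun hm => ?_, fun hm => wd_mem_iter_of_le hσ hm z⟩
  rcases hl with hz | hl
  · by_contra hlt
    obtain ⟨d, rfl⟩ := Nat.exists_eq_add_of_le (not_le.mp hlt)
    rw [Nat.succ_eq_add_one, add_assoc, wd_mem_iter hσ] at hm
    exact hz (mem_iter_of_le hσ (Nat.le_add_right 1 d) hm)
  · exact hl

/-- In terms of words, having a common ancestor means having a common tail. The condition on the
lengths ensures that no ancestor of `z` itself is involved. -/
lemma meets_wd_iff (hσ : ∀ k x, σ (γ k x) = x) {k l : List (Fin N)} {z : X}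
    {m n : ℕ} (hk : z ∉ iter γ 1 ∨ m ≤ k.length) (hl : z ∉ iter γ 1 ∨ n ≤ l.length)
    (hinj : wd γ (k.drop m) z = wd γ (l.drop n) z → k.drop m = l.drop n) :
    Meets γ σ m n (wd γ k z) (wd γ l z) ↔
      m ≤ k.length ∧ n ≤ l.length ∧ k.drop m = l.drop n := by
  rw [Meets, wd_mem_iter_iff hσ hk, wd_mem_iter_iff hσ hl]
  refine and_congr_right fun hm => and_congr_right fun hn => ?_
  rw [sigma_iter_wd hσ hm, sigma_iter_wd hσ hn]
  exact ⟨hinj, fun heq => by rw [heq]⟩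

lemma entry_sum_mono_wd (h : IsAdmissible γ S) (hσ : ∀ k x, σ (γ k x) = x) {ι : Type*}
    (Q : Finset ι) (a b : ι → C(X, ℂ)) (m n : ι → ℕ) {M : ℕ} (hm : ∀ t ∈ Q, m t ≤ M)
    (hn : ∀ t ∈ Q, n t ≤ M) {k l : List (Fin N)} {z : S} (hz : (z : X) ∈ aperiodic γ σ S)
    (hk : (z : X) ∉ iter γ 1 ∨ M ≤ k.length) (hl : (z : X) ∉ iter γ 1 ∨ M ≤ l.length) :
    entry (∑ t ∈ Q, mono h (a t) (m t) (n t) (b t)) (wdS h k z) (wdS h l z) =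
      wordKernel Q a b m n γ k l z := by
  classical
  rw [entry_sum, wordKernel]
  refine Finset.sum_congr rfl fun t ht => ?_
  rw [entry_mono h hσ]
  refine if_congr (meets_wd_iff hσ (hk.imp_right (hm t ht).trans) (hl.imp_right (hn t ht).trans)
    fun heq => wd_injective_of_aperiodic h hσ hz heq) rfl rfl

/-- By continuity, a bound on the quadratic forms of a sum of monomials along the forward orbits of
aperiodic points carries over to the word kernel at every point of `S`. -/
lemma re_sum_wordKernel_le (h : IsAdmissible γ S) (hσ : ∀ k x, σ (γ k x) = x)
    (hcl : IsClopen (iter γ 1)) (hdense : Dense (aperiodic γ σ S)) {ι κ : Type*}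
    (Q : Finset ι) (a b : ι → C(X, ℂ)) (m n : ι → ℕ) {M : ℕ} (hm : ∀ t ∈ Q, m t ≤ M)
    (hn : ∀ t ∈ Q, n t ≤ M) {C : ℝ} (F : Finset κ) (w : κ → List (Fin N)) (η ξ : κ → ℂ)
    (H : ∀ z : S, (z : X) ∈ aperiodic γ σ S →
      ∑ p ∈ F, ∑ q ∈ F, (star (η p) * ξ q *
        entry (∑ t ∈ Q, mono h (a t) (m t) (n t) (b t)) (wdS h (w p) z) (wdS h (w q) z)).re ≤ C)
    {z : X} (hz : ∀ p ∈ F, z ∉ iter γ 1 ∨ M ≤ (w p).length) :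
    ∑ p ∈ F, ∑ q ∈ F, (star (η p) * ξ q * wordKernel Q a b m n γ (w p) (w q) z).re ≤ C := by
  -- If `z` is not in the clopen set `γ(X)`, then neither are the aperiodic points close to it.
  set O : Set X := {z' | z ∉ iter γ 1 → z' ∉ iter γ 1} with hO
  have hOopen : IsOpen O := by
    by_cases hz1 : z ∈ iter γ 1
    · have : O = univ := by ext; simp [hO, hz1]
      rw [this]
      exact isOpen_univ
    · have : O = (iter γ 1)ᶜ := by ext; simp [hO, hz1]
      rw [this]
      exact hcl.isClosed.isOpen_compl
  have hclosed : IsClosed {z' : X | ∑ p ∈ F, ∑ q ∈ F,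
      (star (η p) * ξ q * wordKernel Q a b m n γ (w p) (w q) z').re ≤ C} := by
    refine isClosed_le ?_ continuous_const
    refine continuous_finsetSum F fun p _ => continuous_finsetSum F fun q _ => ?_
    exact Complex.continuous_re.comp (continuous_const.mul (continuous_wordKernel Q a b m n _ _))
  have hzO : z ∈ closure (O ∩ aperiodic γ σ S) :=
    hdense.open_subset_closure_inter hOopen fun hz => hz
  refine closure_minimal ?_ hclosed hzO
  rintro z' ⟨hz'O, hz'⟩
  have hz'F : ∀ p ∈ F, z' ∉ iter γ 1 ∨ M ≤ (w p).length := fun p hp =>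
    (hz p hp).imp_left hz'O
  refine le_of_eq_of_le ?_ (H ⟨z', hz'.1⟩ hz')
  refine Finset.sum_congr rfl fun p hp => Finset.sum_congr rfl fun q hq => ?_
  rw [entry_sum_mono_wd h hσ Q a b m n hm hn hz' (hz'F p hp) (hz'F q hq)]

/-- The number of pairs in `{0, …, L-1}²` on the line `l + n = l' + m` is asymptotic to `L`. -/
lemma tendsto_card_line (m n : ℕ) :
    Filter.Tendsto (fun L : ℕ => (∑ l ∈ Finset.range L, ∑ l' ∈ Finset.range L,
      if l + n = l' + m then (1 : ℝ) else 0) / L) Filter.atTop (𝓝 1) := by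
  have hupper : ∀ L : ℕ, (∑ l ∈ Finset.range L, ∑ l' ∈ Finset.range L,
      if l + n = l' + m then (1 : ℝ) else 0) ≤ L := by
    intro L
    calc _ ≤ ∑ l ∈ Finset.range L, (1 : ℝ) := by
          refine Finset.sum_le_sum fun l _ => ?_
          rw [Finset.sum_boole]
          have : ((Finset.range L).filter fun l' => l + n = l' + m).card ≤ 1 :=
            Finset.card_le_one.mpr fun x hx y hy => by
              have := (Finset.mem_filter.mp hx).2
              have := (Finset.mem_filter.mp hy).2
              omega
          exact_mod_cast this
      _ = L := by simp
  have hlower : ∀ L : ℕ, (L : ℝ) - (m + n) ≤ ∑ l ∈ Finset.range L, ∑ l' ∈ Finset.range L,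
      if l + n = l' + m then (1 : ℝ) else 0 := by
    intro L
    calc (L : ℝ) - (m + n) ≤ ((L - n - m : ℕ) : ℝ) := by
          have : (L : ℝ) ≤ ((L - n - m : ℕ) : ℝ) + m + n := by
            exact_mod_cast (by omega : L ≤ L - n - m + m + n)
          linarith
      _ = ∑ l ∈ Finset.Ico m (L - n), (1 : ℝ) := by simp
      _ ≤ ∑ l ∈ Finset.Ico m (L - n), ∑ l' ∈ Finset.range L,
            if l + n = l' + m then (1 : ℝ) else 0 := by
          refine Finset.sum_le_sum fun l hl => ?_
          rw [Finset.mem_Ico] at hl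
          have hmem : l + n - m ∈ Finset.range L := Finset.mem_range.mpr (by omega)
          refine le_of_eq_of_le ?_ (Finset.single_le_sum
            (f := fun l' => if l + n = l' + m then (1 : ℝ) else 0)
            (fun i _ => by split_ifs <;> norm_num) hmem)
          rw [if_pos (by omega)]
      _ ≤ _ := by
          refine Finset.sum_le_sum_of_subset_of_nonneg (fun l hl => ?_) fun l _ _ => ?_
          · rw [Finset.mem_Ico] at hl
            exact Finset.mem_range.mpr (by omega)
          · exact Finset.sum_nonneg fun l' _ => by split_ifs <;> norm_num
  have hlim : Filter.Tendsto (fun L : ℕ => 1 - ((m : ℝ) + n) / L) Filter.atTop (𝓝 1) := by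
    simpa using (tendsto_const_div_atTop_nhds_zero_nat ((m : ℝ) + n)).const_sub 1
  refine tendsto_of_tendsto_of_tendsto_of_le_of_le' hlim tendsto_const_nhds ?_ ?_
  · filter_upwards [Filter.eventually_gt_atTop 0] with L hL
    have hL' : (0 : ℝ) < L := by exact_mod_cast hL
    rw [le_div_iff₀ hL', sub_mul, one_mul, div_mul_cancel₀ _ hL'.ne']
    exact hlower L
  · filter_upwards [Filter.eventually_gt_atTop 0] with L hL
    have hL' : (0 : ℝ) < L := by exact_mod_cast hL
    rw [div_le_one hL']
    exact hupper L

end kernel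

section key

variable {X : Type*} [TopologicalSpace X] [CompactSpace X] [T2Space X] {N : ℕ}
  {γ : Fin N → C(X, X)} {S : Set X} {σ : X → X}

open Classical in
/-- The generation of the oldest ancestor of `x` that is at most `D` generations old. -/
noncomputable def depth (γ : Fin N → C(X, X)) (D : ℕ) (x : X) : ℕ :=
  Nat.findGreatest (fun t => x ∈ iter γ t) D

open Classical in
lemma depth_le (D : ℕ) (x : X) : depth γ D x ≤ D := Nat.findGreatest_le D

open Classical in
lemma mem_iter_depth (D : ℕ) (x : X) : x ∈ iter γ (depth γ D x) :=
  Nat.findGreatest_spec (P := fun t => x ∈ iter γ t) (Nat.zero_le D) (mem_iter_zero x)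

open Classical in
lemma le_depth {D t : ℕ} {x : X} (ht : t ≤ D) (hx : x ∈ iter γ t) : t ≤ depth γ D x :=
  Nat.le_findGreatest ht hx

lemma depth_add (hσ : ∀ k x, σ (γ k x) = x) {m D : ℕ} {x : X} (hx : x ∈ iter γ m) :
    depth γ (m + D) x = m + depth γ D (σ^[m] x) := by
  apply le_antisymm
  · obtain ⟨d, hd⟩ := Nat.exists_eq_add_of_le (le_depth (Nat.le_add_right m D) hx)
    have h1 := mem_iter_depth (γ := γ) (m + D) x
    have h2 := depth_le (γ := γ) (m + D) x
    rw [hd] at h1 h2 ⊢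
    exact Nat.add_le_add_left
      (le_depth (by omega) ((mem_iter_add hσ).mp h1).2) m
  · refine le_depth (Nat.add_le_add_left (depth_le _ _) m) ?_
    exact (mem_iter_add hσ).mpr ⟨hx, mem_iter_depth _ _⟩

lemma eq_depth_of_mem (hσ : ∀ k x, σ (γ k x) = x) {D : ℕ} {x : X}
    (hx : σ^[depth γ D x] x ∈ iter γ 1) : depth γ D x = D := by
  by_contra hne
  have hlt : depth γ D x < D := lt_of_le_of_ne (depth_le D x) hne
  have := le_depth (x := x) (Nat.succ_le_of_lt hlt)
    ((mem_iter_add hσ).mpr ⟨mem_iter_depth D x, hx⟩)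
  omega

lemma Meets.depth_eq (hσ : ∀ k x, σ (γ k x) = x) {m n D D' : ℕ} {x y : X}
    (hm : Meets γ σ m n x y) (hmD : m ≤ D) (hD : D + n = D' + m) :
    σ^[depth γ D x] x = σ^[depth γ D' y] y ∧ depth γ D x + n = depth γ D' y + m := by
  obtain ⟨d, rfl⟩ := Nat.exists_eq_add_of_le hmD
  obtain rfl : D' = n + d := by omega
  rw [depth_add hσ hm.1, depth_add hσ hm.2.1, hm.2.2]
  refine ⟨?_, by omega⟩
  rw [add_comm m, add_comm n, Function.iterate_add_apply, Function.iterate_add_apply, hm.2.2]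

/-- **A bound along the forward orbits of aperiodic points bounds the whole operator.**
Each point `x` of `S` is placed on the levels `l = 0, …, L - 1`. The pairs `(x, l)` fall into
finitely many classes with a common ancestor `(z, l₀)`, where `σ` lowers the level by one; in each
class the monomials act through words starting at `z`, so that `re_sum_wordKernel_le` applies.
Periodic points thus get unrolled, and averaging over the levels undoes this as `L → ∞`, because a
monomial shifts the level by a bounded amount. -/
lemma norm_sum_mono_le (h : IsAdmissible γ S) (hσ : ∀ k x, σ (γ k x) = x)
    (hcl : IsClopen (iter γ 1)) (hdense : Dense (aperiodic γ σ S)) {ι : Type*}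
    (Q : Finset ι) (a b : ι → C(X, ℂ)) (m n : ι → ℕ) {C : ℝ} (hC : 0 ≤ C)
    (H : ∀ (F : Finset (S × ℕ)) (w : S × ℕ → List (Fin N)), InjOn w F → ∀ η ξ : S × ℕ → ℂ,
      ∀ z : S, (z : X) ∈ aperiodic γ σ S →
      ∑ p ∈ F, ∑ q ∈ F, (star (η p) * ξ q *
        entry (∑ t ∈ Q, mono h (a t) (m t) (n t) (b t)) (wdS h (w p) z) (wdS h (w q) z)).re ≤
        ∑ p ∈ F, C / 2 * (‖η p‖ ^ 2 + ‖ξ p‖ ^ 2)) :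
    ‖∑ t ∈ Q, mono h (a t) (m t) (n t) (b t)‖ ≤ C := by
  classical
  refine norm_le_of_re_sum_le hC fun F η ξ => ?_
  obtain ⟨M, hM⟩ : ∃ M, ∀ t ∈ Q, m t ≤ M ∧ n t ≤ M :=
    ⟨Q.sup fun t => max (m t) (n t), fun t ht =>
      ⟨(le_max_left _ _).trans (Finset.le_sup (f := fun t => max (m t) (n t)) ht),
        (le_max_right _ _).trans (Finset.le_sup (f := fun t => max (m t) (n t)) ht)⟩⟩
  -- The depth, the ancestor and the word of a point on a level.
  set d : S × ℕ → ℕ := fun p => depth γ (p.2 + M) (p.1 : X) with hd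
  have hw : ∀ p : S × ℕ, ∃ w : List (Fin N), w.length = d p ∧ wd γ w (σ^[d p] p.1) = p.1 :=
    fun p => exists_wd hσ (mem_iter_depth _ _)
  choose w hwl hww using hw
  -- The class of a point on a level is its ancestor together with the level of the latter.
  set c : S × ℕ → X × ℤ := fun p => (σ^[d p] p.1, (p.2 : ℤ) - d p) with hcdef
  set coef : ι → S × ℕ → S × ℕ → ℂ := fun t p q =>
    if Meets γ σ (m t) (n t) (p.1 : X) q.1 then a t p.1 * b t q.1 else 0 with hcoef
  set g : S × ℕ → S × ℕ → ℝ := fun p q => ∑ t ∈ Q, if p.2 + n t = q.2 + m t then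
    (star (η p.1) * ξ q.1 * coef t p q).re else 0 with hg
  -- Points with a common ancestor at the right levels are in one class, as the depth is cut off at
  -- level `-M`.
  have hclass : ∀ p q, c p ≠ c q → g p q = 0 := by
    intro p q hpq
    refine Finset.sum_eq_zero fun t ht => ?_
    split_ifs with hlev
    · rw [hcoef]
      dsimp only
      rw [if_neg, mul_zero, Complex.zero_re]
      intro hmeet
      have h1 := hmeet.depth_eq hσ (D := p.2 + M) (D' := q.2 + M)
        ((hM t ht).1.trans (Nat.le_add_left _ _)) (by omega)
      refine hpq (Prod.ext h1.1 ?_)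
      have h2 : d p + n t = d q + m t := h1.2
      change (p.2 : ℤ) - d p = q.2 - d q
      omega
    · rfl
  have hword : ∀ p q, c p = c q → (star (η p.1) * ξ q.1 *
      wordKernel Q a b m n γ (w p) (w q) (c p).1).re = g p q := by
    intro p q hpq
    rw [wordKernel, Finset.mul_sum, Complex.re_sum]
    refine Finset.sum_congr rfl fun t ht => ?_
    have hz : σ^[d p] (p.1 : X) = σ^[d q] (q.1 : X) := congrArg Prod.fst hpq
    have hlev : (p.2 : ℤ) - d p = q.2 - d q := congrArg Prod.snd hpq
    have hwp : wd γ (w p) (c p).1 = p.1 := hww p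
    have hwq : wd γ (w q) (c p).1 = q.1 := by rw [hpq]; exact hww q
    have hzS : (c p).1 ∈ S := sigma_iter_mem h hσ p.1.2 (mem_iter_depth _ _)
    have hiff : (m t ≤ (w p).length ∧ n t ≤ (w q).length ∧
        (w p).drop (m t) = (w q).drop (n t)) ↔
        p.2 + n t = q.2 + m t ∧ Meets γ σ (m t) (n t) (p.1 : X) q.1 := by
      constructor
      · rintro ⟨h1, h2, h3⟩
        have h4 := congrArg List.length h3
        rw [List.length_drop, List.length_drop] at h4
        have h5 := hwl p
        have h6 := hwl q
        refine ⟨by omega, ?_⟩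
        rw [← hwp, ← hwq]
        refine ⟨wd_mem_iter_of_le hσ h1 _, wd_mem_iter_of_le hσ h2 _, ?_⟩
        rw [sigma_iter_wd hσ h1, sigma_iter_wd hσ h2, h3]
      · rintro ⟨h1, h2⟩
        have h3 : m t ≤ (w p).length := by
          rw [hwl]
          exact le_depth ((hM t ht).1.trans (Nat.le_add_left _ _)) h2.1
        have h4 : n t ≤ (w q).length := by
          rw [hwl]
          exact le_depth ((hM t ht).2.trans (Nat.le_add_left _ _)) h2.2.1
        have h5 := hwl p
        have h6 := hwl q
        refine ⟨h3, h4, wd_injective h hzS ?_ ?_⟩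
        · rw [List.length_drop, List.length_drop]
          omega
        · rw [← sigma_iter_wd hσ h3, ← sigma_iter_wd hσ h4, hwp, hwq]
          exact h2.2.2
    rw [hwp, hwq, if_congr hiff rfl rfl, hcoef]
    dsimp only
    by_cases h1 : p.2 + n t = q.2 + m t
    · simp only [h1, true_and, if_true]
    · simp only [h1, false_and, if_false, mul_zero, Complex.zero_re]
  -- The bound for finitely many levels.
  have hL : ∀ L : ℕ, ∑ p ∈ F ×ˢ Finset.range L, ∑ q ∈ F ×ˢ Finset.range L, g p q ≤
      ∑ p ∈ F ×ˢ Finset.range L, C / 2 * (‖η p.1‖ ^ 2 + ‖ξ p.1‖ ^ 2) := by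
    intro L
    have h1 : ∀ p q, g p q = if c p = c q then g p q else 0 := by
      intro p q
      split_ifs with hpq
      · rfl
      · exact hclass p q hpq
    rw [Finset.sum_congr rfl fun p _ => Finset.sum_congr rfl fun q _ => h1 p q]
    refine sum_ite_class_le _ c g _ fun b' hb' => ?_
    obtain ⟨p₀, -, rfl⟩ := Finset.mem_image.mp hb'
    set G := (F ×ˢ Finset.range L).filter fun p => c p = c p₀ with hG
    have hcG : ∀ p ∈ G, c p = c p₀ := fun p hp => (Finset.mem_filter.mp hp).2
    have hinj : InjOn w G := by
      intro p hp q hq hpq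
      have hpq' : c p = c q := (hcG p hp).trans (hcG q hq).symm
      have h2 : (p.1 : X) = q.1 := by
        rw [← hww p, ← hww q, hpq]
        exact congrArg (wd γ (w q)) (congrArg Prod.fst hpq')
      have h3 : d p = d q := by rw [← hwl, ← hwl, hpq]
      have h4 : (p.2 : ℤ) - d p = q.2 - d q := congrArg Prod.snd hpq'
      exact Prod.ext (Subtype.ext h2) (by omega)
    have h2 := re_sum_wordKernel_le h hσ hcl hdense Q a b m n (fun t ht => (hM t ht).1)
      (fun t ht => (hM t ht).2) G w (fun p => η p.1) (fun p => ξ p.1)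
      (H G w hinj (fun p => η p.1) (fun p => ξ p.1)) (z := (c p₀).1) ?_
    · refine le_of_eq_of_le ?_ h2
      refine Finset.sum_congr rfl fun p hp => Finset.sum_congr rfl fun q hq => ?_
      rw [← hword p q ((hcG p hp).trans (hcG q hq).symm), hcG p hp]
    · intro p hp
      rw [← hcG p hp, or_iff_not_imp_left, not_not, hwl]
      intro hz
      rw [show d p = p.2 + M from eq_depth_of_mem hσ hz]
      exact Nat.le_add_left _ _
  -- The average over the levels.
  set s : ι → ℕ → ℝ := fun t L => (∑ l ∈ Finset.range L, ∑ l' ∈ Finset.range L,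
      if l + n t = l' + m t then (1 : ℝ) else 0) / L with hs
  have hcount : ∀ L : ℕ, (∑ p ∈ F ×ˢ Finset.range L, ∑ q ∈ F ×ˢ Finset.range L, g p q) / L =
      ∑ x ∈ F, ∑ y ∈ F, ∑ t ∈ Q, (star (η x) * ξ y * coef t (x, 0) (y, 0)).re * s t L := by
    intro L
    simp only [hs, mul_div_assoc', ← Finset.sum_div]
    congr 1
    simp only [Finset.sum_product, hg]
    refine Finset.sum_congr rfl fun x _ => ?_
    rw [Finset.sum_comm]
    refine Finset.sum_congr rfl fun y _ => ?_
    simp only [Finset.mul_sum]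
    rw [Finset.sum_congr rfl fun l _ => Finset.sum_comm, Finset.sum_comm]
    refine Finset.sum_congr rfl fun t _ => Finset.sum_congr rfl fun l _ =>
      Finset.sum_congr rfl fun l' _ => ?_
    by_cases hll : l + n t = l' + m t
    · rw [if_pos hll, if_pos hll, mul_one]
    · rw [if_neg hll, if_neg hll, mul_zero]
  have hlim : Filter.Tendsto (fun L : ℕ =>
      ∑ x ∈ F, ∑ y ∈ F, ∑ t ∈ Q, (star (η x) * ξ y * coef t (x, 0) (y, 0)).re * s t L)
      Filter.atTop (𝓝 (∑ x ∈ F, ∑ y ∈ F, ∑ t ∈ Q,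
        (star (η x) * ξ y * coef t (x, 0) (y, 0)).re * 1)) :=
    tendsto_finsetSum _ fun x _ => tendsto_finsetSum _ fun y _ => tendsto_finsetSum _ fun t _ =>
      (tendsto_card_line (m t) (n t)).const_mul _
  have hfinal : ∑ x ∈ F, ∑ y ∈ F, (star (η x) * ξ y *
      entry (∑ t ∈ Q, mono h (a t) (m t) (n t) (b t)) x y).re = ∑ x ∈ F, ∑ y ∈ F, ∑ t ∈ Q,
        (star (η x) * ξ y * coef t (x, 0) (y, 0)).re * 1 := by
    refine Finset.sum_congr rfl fun x _ => Finset.sum_congr rfl fun y _ => ?_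
    rw [entry_sum, Finset.mul_sum, Complex.re_sum]
    refine Finset.sum_congr rfl fun t _ => ?_
    rw [mul_one, entry_mono h hσ]
  rw [hfinal]
  refine le_of_tendsto hlim ?_
  filter_upwards [Filter.eventually_gt_atTop 0] with L hL0
  have hL' : (0 : ℝ) < L := by exact_mod_cast hL0
  rw [← hcount, div_le_iff₀ hL']
  refine (hL L).trans_eq ?_
  rw [Finset.sum_product, Finset.sum_mul]
  refine Finset.sum_congr rfl fun x _ => ?_
  simp [mul_comm]

/-- If `α` is diagonal and `β` is a sum of monomials within `ε` of `α`, then the monomials of `β`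
of non-zero degree contribute at most `2ε`. -/
lemma norm_sum_ne_le (h : IsAdmissible γ S) (hσ : ∀ k x, σ (γ k x) = x)
    (hcl : IsClopen (iter γ 1)) (hdense : Dense (aperiodic γ σ S)) {ι : Type*} [Fintype ι]
    (a b : ι → C(X, ℂ)) (m n : ι → ℕ) {α : Mat S} (hα : IsDiagonal α) {ε : ℝ}
    (hε : ‖α - ∑ t, mono h (a t) (m t) (n t) (b t)‖ ≤ ε) :
    ‖∑ t with m t ≠ n t, mono h (a t) (m t) (n t) (b t)‖ ≤ 2 * ε := by
  have hε0 : 0 ≤ ε := (norm_nonneg _).trans hε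
  refine norm_sum_mono_le h hσ hcl hdense _ a b m n (by positivity) fun F w hw η ξ z hz => ?_
  set β := ∑ t, mono h (a t) (m t) (n t) (b t) with hβ
  -- Along a free orbit, the length of words is a grading: it separates `β` by degree, while `α`
  -- only has entries of degree zero.
  have hentry : ∀ k l : List (Fin N),
      entry (∑ t with m t ≠ n t, mono h (a t) (m t) (n t) (b t)) (wdS h k z) (wdS h l z) =
        entry (β - α) (wdS h k z) (wdS h l z) +
          if k.length = l.length then entry (α - β) (wdS h k z) (wdS h l z) else 0 := by
    intro k l
    by_cases hkl : k.length = l.length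
    · rw [if_pos hkl, ← entry_add, sub_add_sub_cancel, sub_self, entry_zero, entry_sum]
      refine Finset.sum_eq_zero fun t ht => ?_
      rw [entry_mono h hσ, if_neg]
      intro hm
      have := length_of_meets_wd h hσ hz hm
      have := (Finset.mem_filter.mp ht).2
      omega
    · have hne : wdS h k z ≠ wdS h l z := fun heq =>
        hkl (congrArg List.length (wd_injective_of_aperiodic h hσ hz (congrArg Subtype.val heq)))
      rw [if_neg hkl, add_zero, entry_sub, hα.entry_eq_zero hne, sub_zero, hβ, entry_sum,
        entry_sum, Finset.sum_filter]
      refine Finset.sum_congr rfl fun t _ => ?_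
      split_ifs with ht
      · rfl
      · rw [entry_mono h hσ, if_neg]
        intro hm
        have := length_of_meets_wd h hσ hz hm
        omega
  have hinj : ∀ G ⊆ F, InjOn (fun p => wdS h (w p) z) G := fun G hG p hp q hq hpq =>
    hw (hG hp) (hG hq) (wd_injective_of_aperiodic h hσ hz (congrArg Subtype.val hpq))
  have h1 := re_sum_le_of_norm_le (T := β - α) (C := ε) (by rwa [norm_sub_rev]) F
    (fun p => wdS h (w p) z) (hinj F subset_rfl) η ξ
  have h2 : ∑ p ∈ F, ∑ q ∈ F, (if (w p).length = (w q).length then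
      (star (η p) * ξ q * entry (α - β) (wdS h (w p) z) (wdS h (w q) z)).re else 0) ≤
      ∑ p ∈ F, ε / 2 * (‖η p‖ ^ 2 + ‖ξ p‖ ^ 2) :=
    sum_ite_class_le F (fun p => (w p).length) _ _ fun r _ =>
      re_sum_le_of_norm_le hε _ _ (hinj _ (Finset.filter_subset _ _)) η ξ
  have h3 := add_le_add h1 h2
  rw [← Finset.sum_add_distrib, ← Finset.sum_add_distrib] at h3
  refine le_trans (le_of_eq ?_) (h3.trans (le_of_eq ?_))
  · refine Finset.sum_congr rfl fun p _ => ?_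
    rw [← Finset.sum_add_distrib]
    refine Finset.sum_congr rfl fun q _ => ?_
    rw [hentry, mul_add, Complex.add_re]
    congr 1
    split_ifs
    · rfl
    · simp
  · refine Finset.sum_congr rfl fun p _ => ?_
    ring

/-- The diagonal matrices in `C*(ρ)` have degree zero. -/
lemma mem_D_of_isDiagonal (h : IsAdmissible γ S) (hσ : ∀ k x, σ (γ k x) = x)
    (hc : ContinuousOn σ (ifsImage γ univ)) (hcl : IsClopen (iter γ 1))
    (hdense : Dense (aperiodic γ σ S)) {α : Mat S} (hα : α ∈ cstarRho h) (hd : IsDiagonal α) :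
    α ∈ D h 0 := by
  refine ⟨?_, hd⟩
  rw [B_eq h hσ]
  refine Metric.mem_closure_iff.mpr fun ε hε => ?_
  obtain ⟨β, hβ, hαβ⟩ := Metric.mem_closure_iff.mp (cstarRho_subset h hσ hc hcl hα) (ε / 3)
    (by positivity)
  obtain ⟨r, f, g, rfl⟩ := Submodule.mem_span_set'.mp hβ
  choose a m n b hg using fun t => (g t).2
  have hsum : ∑ t, f t • (g t : Mat S) = ∑ t, mono h (f t • a t) (m t) (n t) (b t) :=
    Finset.sum_congr rfl fun t _ => by rw [← smul_mono, hg]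
  rw [hsum, dist_eq_norm] at hαβ
  have h1 := norm_sum_ne_le h hσ hcl hdense (fun t => f t • a t) b m n hd hαβ.le
  refine ⟨∑ t with m t = n t, mono h (f t • a t) (m t) (n t) (b t), ?_, ?_⟩
  · refine Submodule.sum_mem _ fun t ht => mono_mem_monoSpan h _ _ ?_
    have := (Finset.mem_filter.mp ht).2
    omega
  · have h2 := Finset.sum_filter_add_sum_filter_not Finset.univ (fun t => m t = n t)
      fun t => mono h (f t • a t) (m t) (n t) (b t)
    rw [← h2] at hαβ
    rw [dist_eq_norm]
    have h3 := norm_add_le (α - (∑ t with m t = n t, mono h (f t • a t) (m t) (n t) (b t) +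
      ∑ t with ¬ m t = n t, mono h (f t • a t) (m t) (n t) (b t)))
      (∑ t with ¬ m t = n t, mono h (f t • a t) (m t) (n t) (b t))
    rw [sub_add_eq_sub_sub, sub_add_cancel, ← sub_add_eq_sub_sub] at h3
    have h1' : ‖∑ t with ¬ m t = n t, mono h (f t • a t) (m t) (n t) (b t)‖ ≤ 2 * (ε / 3) := h1
    linarith

end key

/-! ### Normalizers -/

section normalizers

variable {X : Type*} [TopologicalSpace X] [CompactSpace X] [T2Space X] {N : ℕ}
  {γ : Fin N → C(X, X)} {S : Set X} {σ : X → X}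

/-- Normalizers are closed under products and adjoints. -/
lemma cstarGen_normalizer_subset_closure_span {M : Type*} [CStarAlgebra M] (A : Set M) {s : Set M} :
    (cstarGen (normalizer A (cstarGen s : Set M)) : Set M) ⊆
      closure (Submodule.span ℂ (normalizer A (cstarGen s : Set M)) : Set M) := by
  refine cstarGen_subset_closure_span ?_ ?_ Submodule.subset_span
  · intro x hx y hy
    refine Submodule.subset_span ⟨mul_mem hx.1 hy.1, fun a ha => ?_, fun a ha => ?_⟩
    · have := hx.2.1 _ (hy.2.1 a ha)
      simpa only [star_mul, mul_assoc] using this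
    · have := hy.2.2 _ (hx.2.2 a ha)
      simpa only [star_mul, mul_assoc] using this
  · intro x hx
    refine Submodule.subset_span ⟨star_mem hx.1, fun a ha => ?_, fun a ha => ?_⟩
    · simpa only [star_star] using hx.2.2 a ha
    · simpa only [star_star] using hx.2.1 a ha

lemma cstarGen_normalizer_subset {M : Type*} [CStarAlgebra M] (A : Set M) {s : Set M} :
    (cstarGen (normalizer A (cstarGen s : Set M)) : Set M) ⊆ cstarGen s :=
  cstarGen_subset (isClosed_cstarGen s) fun _ hb => hb.1

lemma rhoA_mem_D (h : IsAdmissible γ S) (hσ : ∀ k x, σ (γ k x) = x) (a : C(X, ℂ)) :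
    rhoA S a ∈ D h 0 :=
  ⟨mono_zero_zero h a ▸ mono_mem_B h hσ a 1 (by simp), isDiagonal_rhoA a⟩

lemma rhoA_apply (a : C(X, ℂ)) (v : L2 S) (x : S) : rhoA S a v x = a x * v x := rfl

/-- Functions of norm at most one that isolate the point `z` from more and more points. -/
lemma exists_bumps (z : S) : ∃ a : Finset S → C(X, ℂ), (∀ F, a F z = 1) ∧
    (∀ F, ∀ x ∈ F, x ≠ z → a F x = 0) ∧ ∀ F x, ‖a F x‖ ≤ 1 := by
  classical
  have (F : Finset S) : ∃ a : C(X, ℂ), a z = 1 ∧ (∀ x ∈ F, x ≠ z → a x = 0) ∧ ∀ x, ‖a x‖ ≤ 1 := by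
    obtain ⟨a, h1, h2, h3⟩ := exists_bump (z := (z : X))
      (F := ((F.erase z).image Subtype.val : Finset X)) (Finset.finite_toSet _).isClosed
      (by simp)
    refine ⟨a, h1, fun x hx hxz => h2 _ ?_, h3⟩
    simp [hx, Subtype.coe_ne_coe.mpr hxz]
  choose a h1 h2 h3 using this
  exact ⟨a, h1, h2, h3⟩

lemma tendsto_inner_rhoA (z : S) {a : Finset S → C(X, ℂ)} (h1 : ∀ F, a F z = 1)
    (h2 : ∀ F, ∀ x ∈ F, x ≠ z → a F x = 0) (h3 : ∀ F x, ‖a F x‖ ≤ 1) (u v : L2 S) :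
    Filter.Tendsto (fun F => inner ℂ u (rhoA S (a F) v)) Filter.atTop (𝓝 (star (u z) * v z)) := by
  classical
  have hsum : Summable fun x => ‖u x‖ * ‖v x‖ :=
    Summable.of_nonneg_of_le (fun x => by positivity)
      (fun x => by nlinarith [sq_nonneg (‖u x‖ - ‖v x‖), sq_nonneg (‖u x‖), sq_nonneg ‖v x‖])
      ((summable_sq u).add (summable_sq v))
  have hlim : star (u z) * v z = ∑' x, if x = z then star (u z) * v z else 0 := by
    rw [tsum_ite_eq]
  rw [hlim]
  simp only [lp.inner_eq_tsum]
  refine tendsto_tsum_of_dominated_convergence hsum (fun x => ?_) (Filter.Eventually.of_forall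
    fun F x => ?_)
  · by_cases hx : x = z
    · subst hx
      refine tendsto_const_nhds.congr fun F => ?_
      rw [if_pos rfl, rhoA_apply, h1, one_mul, RCLike.inner_apply, mul_comm]
      rfl
    · refine tendsto_const_nhds.congr' ?_
      filter_upwards [Filter.eventually_ge_atTop {x}] with F hF
      rw [if_neg hx, rhoA_apply, h2 F x (hF (Finset.mem_singleton_self x)) hx, zero_mul,
        inner_zero_right]
  · refine (norm_inner_le_norm _ _).trans ?_
    rw [rhoA_apply, norm_mul]
    exact mul_le_mul_of_nonneg_left (mul_le_of_le_one_left (norm_nonneg _) (h3 F x))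
      (norm_nonneg _)

/-- If `b a b*` is diagonal for all `a ∈ C(X)`, then so is its limit `b e_z e_z* b*` as `a` shrinks
to the point mass at `z`, so the column `z` of `b` has at most one non-zero entry. -/
lemma eq_of_entry_ne_zero_of_isDiagonal {b : Mat S}
    (hb : ∀ a : C(X, ℂ), IsDiagonal (b * rhoA S a * star b)) {x y z : S} (hx : entry b x z ≠ 0)
    (hy : entry b y z ≠ 0) : x = y := by
  by_contra hxy
  obtain ⟨a, h1, h2, h3⟩ := exists_bumps z
  have hlim := tendsto_inner_rhoA z h1 h2 h3 (star b (e x)) (star b (e y))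
  have h0 : ∀ F, inner ℂ (star b (e x)) (rhoA S (a F) (star b (e y))) = 0 := fun F => by
    have := (hb (a F)).entry_eq_zero hxy
    rwa [mul_assoc, entry_mul, mul_apply_eq_comp] at this
  simp only [h0] at hlim
  have := tendsto_nhds_unique hlim tendsto_const_nhds
  rw [apply_e_apply, apply_e_apply, entry_star, entry_star, star_star] at this
  exact mul_ne_zero hx (star_ne_zero.mpr hy) this

lemma isQuasiMonomial_of_mem_normalizer (h : IsAdmissible γ S) (hσ : ∀ k x, σ (γ k x) = x)
    {b : Mat S} (hb : b ∈ normalizer (D h 0) (cstarRho h)) : IsQuasiMonomial b := by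
  constructor
  · intro x y z hy hz
    refine eq_of_entry_ne_zero_of_isDiagonal (b := star b) (z := x) (fun a => ?_) ?_ ?_
    · rw [star_star]
      exact (hb.2.2 _ (rhoA_mem_D h hσ a)).2
    · rwa [entry_star, star_ne_zero]
    · rwa [entry_star, star_ne_zero]
  · intro x y z hx hy
    exact eq_of_entry_ne_zero_of_isDiagonal (fun a => (hb.2.1 _ (rhoA_mem_D h hσ a)).2) hx hy

lemma normalizer_D_eq (h : IsAdmissible γ S) (hσ : ∀ k x, σ (γ k x) = x)
    (hc : ContinuousOn σ (ifsImage γ univ)) (hcl : IsClopen (iter γ 1))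
    (hdense : Dense (aperiodic γ σ S)) :
    normalizer (D h 0) (cstarRho h) = cstarRho h ∩ {α | IsQuasiMonomial α} := by
  ext b
  refine ⟨fun hb => ⟨hb.1, isQuasiMonomial_of_mem_normalizer h hσ hb⟩, fun hb => ?_⟩
  have hsub : D h 0 ⊆ cstarRho h := fun α hα => B_subset h hσ 0 hα.1
  have hbs : star b ∈ cstarRho h := star_mem (S := NonUnitalStarSubalgebra ℂ (Mat S)) hb.1
  have hmul : ∀ {x y : Mat S}, x ∈ cstarRho h → y ∈ cstarRho h → x * y ∈ cstarRho h :=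
    fun hx hy => mul_mem (S := NonUnitalStarSubalgebra ℂ (Mat S)) hx hy
  refine ⟨hb.1, fun α hα => ?_, fun α hα => ?_⟩
  · exact mem_D_of_isDiagonal h hσ hc hcl hdense (hmul (hmul hb.1 (hsub hα)) hbs)
      (hb.2.conj_isDiagonal hα.2)
  · refine mem_D_of_isDiagonal h hσ hc hcl hdense (hmul (hmul hbs (hsub hα)) hb.1) ?_
    simpa using IsQuasiMonomial.conj_isDiagonal hb.2.star hα.2

end normalizers

section hat

variable {X : Type*} [TopologicalSpace X] [CompactSpace X] [T2Space X] {N : ℕ}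
  {γ : Fin N → C(X, X)} {S : Set X} {σ : X → X}

/-! ### The stabilised algebra -/

lemma tens_apply {S : Type*} (α : Mat S) (n : ℤ) (ξ : L2Z S) (k : ℤ) :
    tens α n ξ k = α (ξ (k - n)) := rfl

lemma tens_mul {S : Type*} (α β : Mat S) (m n : ℤ) :
    tens α m * tens β n = tens (α * β) (m + n) := by
  ext1 ξ
  ext1
  funext k
  rw [mul_apply_eq_comp, tens_apply, tens_apply, tens_apply, mul_apply_eq_comp, sub_sub]

lemma star_tens {S : Type*} (α : Mat S) (n : ℤ) : star (tens α n) = tens (star α) (-n) := by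
  rw [eq_comm, ContinuousLinearMap.star_eq_adjoint (tens α n),
    ContinuousLinearMap.eq_adjoint_iff]
  intro ξ η
  rw [lp.inner_eq_tsum, lp.inner_eq_tsum, ← (Equiv.addRight n).tsum_eq fun k =>
    inner ℂ (ξ k) (tens α n η k)]
  refine tsum_congr fun k => ?_
  rw [tens_apply, tens_apply, ContinuousLinearMap.star_eq_adjoint,
    ContinuousLinearMap.adjoint_inner_left, sub_neg_eq_add, Equiv.coe_addRight,
    add_sub_cancel_right]

/-- `α ↦ α ⊗ υ_n` as a continuous linear map. -/
noncomputable def tensL (S : Type*) (n : ℤ) : Mat S →L[ℂ] MatZ S :=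
  LinearMap.mkContinuous
    { toFun := fun α => tens α n
      map_add' := fun _ _ => rfl
      map_smul' := fun _ _ => rfl }
    1 fun α => by
      rw [one_mul]
      change ‖tens α n‖ ≤ ‖α‖
      unfold tens compOp
      exact LinearMap.mkContinuous_norm_le _ (norm_nonneg α) _

lemma tensL_apply {S : Type*} (α : Mat S) (n : ℤ) : tensL S n α = tens α n := rfl

/-- The basis vector `e_x ⊗ e_k` of `ℓ²(S) ⊗ ℓ²(ℤ)`. -/
noncomputable def eZ {S : Type*} (x : S) (k : ℤ) : L2Z S := lp.single 2 k (e x)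

lemma inner_eZ {S : Type*} (x : S) (k : ℤ) (ξ : L2Z S) : inner ℂ (eZ x k) ξ = ξ k x := by
  rw [eZ, lp.inner_single_left, inner_e]

lemma norm_eZ {S : Type*} (x : S) (k : ℤ) : ‖eZ x k‖ = 1 := by
  rw [eZ, lp.norm_single (by norm_num), norm_e]

/-- Taking an entry of an operator on `ℓ²(S) ⊗ ℓ²(ℤ)`. -/
noncomputable def entryZ {S : Type*} (x : S) (k : ℤ) (y : S) (l : ℤ) : MatZ S →L[ℂ] ℂ :=
  (innerSL ℂ (eZ x k)).comp (ContinuousLinearMap.apply ℂ (L2Z S) (eZ y l))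

lemma entryZ_apply {S : Type*} (x : S) (k : ℤ) (y : S) (l : ℤ) (b : MatZ S) :
    entryZ x k y l b = b (eZ y l) k x := inner_eZ x k _

lemma norm_entryZ_le {S : Type*} (x : S) (k : ℤ) (y : S) (l : ℤ) (b : MatZ S) :
    ‖entryZ x k y l b‖ ≤ ‖b‖ := by
  refine (norm_inner_le_norm (eZ x k) (b (eZ y l))).trans ?_
  rw [norm_eZ, one_mul]
  simpa [norm_eZ] using b.le_opNorm (eZ y l)

lemma entryZ_tens {S : Type*} (x : S) (k : ℤ) (y : S) (l : ℤ) (α : Mat S) (n : ℤ) :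
    entryZ x k y l (tens α n) = if k = n + l then entry α x y else 0 := by
  rw [entryZ_apply, eZ, tens_single]
  by_cases hk : k = n + l
  · subst hk
    simp [apply_e_apply]
  · simp [hk]

lemma entryZ_star {S : Type*} (x : S) (k : ℤ) (y : S) (l : ℤ) (b : MatZ S) :
    entryZ x k y l (star b) = star (entryZ y l x k b) := by
  change inner ℂ (eZ x k) (star b (eZ y l)) = star (inner ℂ (eZ y l) (b (eZ x k)))
  rw [ContinuousLinearMap.star_eq_adjoint, ContinuousLinearMap.adjoint_inner_right,
    ← inner_conj_symm]
  rfl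

/-- The elementary tensors spanning `C*(ρ̂)`. -/
def monosHat (h : IsAdmissible γ S) : Set (MatZ S) :=
  {ξ | ∃ (a : C(X, ℂ)) (m n : ℕ) (b : C(X, ℂ)), ξ = tens (mono h a m n b) (m - n)}

lemma cstarRhoHat_subset (h : IsAdmissible γ S) (hσ : ∀ k x, σ (γ k x) = x)
    (hc : ContinuousOn σ (ifsImage γ univ)) (hcl : IsClopen (iter γ 1)) :
    cstarRhoHat h ⊆ closure (Submodule.span ℂ (monosHat h) : Set (MatZ S)) := by
  refine cstarGen_subset_closure_span ?_ ?_ ?_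
  · rintro _ ⟨a, m, n, b, rfl⟩ _ ⟨a', m', n', b', rfl⟩
    obtain ⟨a'', b'', m'', n'', h1, h2⟩ := exists_mono_mul_mono h hσ hc hcl a b a' b' m n m' n'
    exact Submodule.subset_span ⟨a'', m'', n'', b'', by rw [tens_mul, h1, h2]⟩
  · rintro _ ⟨a, m, n, b, rfl⟩
    exact Submodule.subset_span ⟨_, _, _, _, by rw [star_tens, star_mono, neg_sub]⟩
  · rintro _ (⟨a, rfl⟩ | ⟨f, rfl⟩)
    · exact Submodule.subset_span ⟨a, 0, 0, 1, by simp [mono_zero_zero]⟩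
    · obtain ⟨a, ha⟩ := exists_rhoE_eq h hσ hc hcl f
      exact Submodule.subset_span ⟨a, 1, 0, 1, by simp [mono, ha, rhoA_one]⟩

lemma tens_rhoA_mem (h : IsAdmissible γ S) (a : C(X, ℂ)) :
    tens (rhoA S a) 0 ∈ cstarRhoHat h := subset_cstarGen _ (Or.inl ⟨a, rfl⟩)

lemma cstarRhoHat_mul {h : IsAdmissible γ S} {x y : MatZ S} (hx : x ∈ cstarRhoHat h)
    (hy : y ∈ cstarRhoHat h) : x * y ∈ cstarRhoHat h :=
  mul_mem (S := NonUnitalStarSubalgebra ℂ (MatZ S)) hx hy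

lemma tens_rhoA_mul_shift_pow_mem (h : IsAdmissible γ S) (a : C(X, ℂ)) (m : ℕ) :
    tens (rhoA S a * shift h ^ m) m ∈ cstarRhoHat h := by
  induction m with
  | zero => simpa using tens_rhoA_mem h a
  | succ m ih =>
    rw [pow_succ, ← mul_assoc, Nat.cast_succ, ← tens_mul]
    exact cstarRhoHat_mul ih (subset_cstarGen _ (Or.inr ⟨1, rfl⟩))

lemma tens_mem_cstarRhoHat (h : IsAdmissible γ S) (hσ : ∀ k x, σ (γ k x) = x) {k : ℤ} {α : Mat S}
    (hα : α ∈ B h k) : tens α k ∈ cstarRhoHat h := by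
  rw [B_eq h hσ] at hα
  have hcl : IsClosed (cstarRhoHat h) := isClosed_cstarGen _
  have hmono : ∀ β ∈ monoSpan h k, tensL S k β ∈ cstarRhoHat h := by
    change monoSpan h k ≤ (cstarGen _).toSubmodule.comap
      (tensL S k : Mat S →ₗ[ℂ] MatZ S)
    refine Submodule.span_le.mpr ?_
    rintro _ ⟨a, m, n, b, rfl, rfl⟩
    have h1 := star_mem (S := NonUnitalStarSubalgebra ℂ (MatZ S))
      (tens_rhoA_mul_shift_pow_mem h (star b) n)
    have h2 := cstarRhoHat_mul (tens_rhoA_mul_shift_pow_mem h a m) h1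
    rw [star_tens, tens_mul, star_mul, star_pow, rhoA_star, star_star, ← mul_assoc,
      ← sub_eq_add_neg] at h2
    exact h2
  exact closure_minimal hmono (hcl.preimage (tensL S k).continuous) hα

lemma isCStarSubalgebra_DHat (h : IsAdmissible γ S) (hσ : ∀ k x, σ (γ k x) = x)
    (hc : ContinuousOn σ (ifsImage γ univ)) (hcl : IsClopen (iter γ 1)) :
    IsCStarSubalgebra (DHat h) (cstarRhoHat h) := by
  refine ⟨?_, (spanSubalgebra {ξ | ∃ k : ℤ, ∃ α ∈ D h k, ξ = tens α k} ?_ ?_).topologicalClosure,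
    rfl, Submodule.isClosed_topologicalClosure _⟩
  · refine closure_minimal ?_ (isClosed_cstarGen _)
    change _ ≤ (cstarGen _).toSubmodule
    refine Submodule.span_le.mpr ?_
    rintro _ ⟨k, α, hα, rfl⟩
    exact tens_mem_cstarRhoHat h hσ hα.1
  · rintro _ ⟨k, α, hα, rfl⟩ _ ⟨l, β, hβ, rfl⟩
    exact Submodule.subset_span ⟨k + l, α * β, ⟨B_mul h hσ hc hcl hα.1 hβ.1, hα.2.mul hβ.2⟩,
      tens_mul _ _ _ _⟩
  · rintro _ ⟨k, α, hα, rfl⟩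
    exact Submodule.subset_span ⟨-k, star α, ⟨B_star h hσ hα.1, hα.2.star⟩, star_tens _ _⟩

lemma tens_mem_DHat (h : IsAdmissible γ S) {k : ℤ} {α : Mat S} (hα : α ∈ D h k) :
    tens α k ∈ DHat h :=
  subset_closure (Submodule.subset_span ⟨k, α, hα, rfl⟩)

lemma entryZ_eq_zero_of_mem_DHat (h : IsAdmissible γ S) {b : MatZ S} (hb : b ∈ DHat h) {x y : S}
    (hxy : x ≠ y) (k l : ℤ) : entryZ x k y l b = 0 := by
  refine closure_minimal (t := {b | entryZ x k y l b = 0}) ?_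
    (isClosed_eq (entryZ x k y l).continuous continuous_const) hb
  change _ ≤ LinearMap.ker (entryZ x k y l : MatZ S →ₗ[ℂ] ℂ)
  refine Submodule.span_le.mpr ?_
  rintro _ ⟨j, α, hα, rfl⟩
  change entryZ x k y l (tens α j) = 0
  rw [entryZ_tens, hα.2.entry_eq_zero hxy, ite_self]

lemma tendsto_inner_tens_rhoA (z : S) {a : Finset S → C(X, ℂ)} (h1 : ∀ F, a F z = 1)
    (h2 : ∀ F, ∀ x ∈ F, x ≠ z → a F x = 0) (h3 : ∀ F x, ‖a F x‖ ≤ 1) (u v : L2Z S) :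
    Filter.Tendsto (fun F => inner ℂ u (tens (rhoA S (a F)) 0 v)) Filter.atTop
      (𝓝 (∑' l, star (u l z) * v l z)) := by
  have hsum : Summable fun l => ‖u l‖ * ‖v l‖ :=
    Summable.of_nonneg_of_le (fun x => by positivity)
      (fun x => by nlinarith [sq_nonneg (‖u x‖ - ‖v x‖), sq_nonneg (‖u x‖), sq_nonneg ‖v x‖])
      ((summable_sq u).add (summable_sq v))
  simp only [lp.inner_eq_tsum u]
  refine tendsto_tsum_of_dominated_convergence hsum (fun l => ?_) (Filter.Eventually.of_forall
    fun F l => ?_)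
  · simp only [tens_apply, sub_zero]
    exact tendsto_inner_rhoA z h1 h2 h3 (u l) (v l)
  · refine (norm_inner_le_norm _ _).trans (mul_le_mul_of_nonneg_left ?_ (norm_nonneg _))
    rw [tens_apply, sub_zero]
    refine ((rhoA S (a F)).le_opNorm _).trans (mul_le_of_le_one_left (norm_nonneg _) ?_)
    exact (norm_mulOp_le _ _).trans ((ContinuousMap.norm_le _ zero_le_one).mpr (h3 F))

end hat

section regularity

variable {X : Type*} [TopologicalSpace X] [CompactSpace X] [T2Space X] {N : ℕ}
  {γ : Fin N → C(X, X)} {S : Set X} {σ : X → X}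

/-! ### Graph separation implies regularity -/

lemma isClopen_range (hσ : ∀ k x, σ (γ k x) = x) (hcl : IsClopen (iter γ 1))
    (hsep : GraphSeparation γ) (k : Fin N) : IsClopen (range (γ k)) := by
  have hclosed : ∀ j, IsClosed (range (γ j)) := fun j =>
    (isCompact_range (γ j).continuous).isClosed
  refine ⟨hclosed k, ?_⟩
  have : range (γ k) = iter γ 1 ∩ (⋃ j ∈ {j | j ≠ k}, range (γ j))ᶜ := by
    ext x
    simp only [mem_inter_iff, mem_compl_iff, mem_iUnion, mem_iter_succ, not_exists]
    constructor
    · rintro ⟨y, rfl⟩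
      refine ⟨⟨k, y, mem_iter_zero y, rfl⟩, ?_⟩
      rintro j hj ⟨z, hz⟩
      have := congrArg σ hz
      rw [hσ, hσ] at this
      subst this
      exact hsep j k hj _ hz
    · rintro ⟨⟨j, y, -, rfl⟩, hx⟩
      by_cases hj : j = k
      · subst hj
        exact mem_range_self y
      · exact absurd (mem_range_self y) (hx j hj)
  rw [this]
  exact hcl.isOpen.inter
    ((Set.toFinite {j | j ≠ k}).isClosed_biUnion fun j _ => hclosed j).isOpen_compl

/-- Under graph separation, `T` is the sum of quasi-monomial operators `p_k T`, where `p_k` is the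
indicator function of the clopen set `γ_k(X)`. -/
lemma exists_branches (h : IsAdmissible γ S) (hσ : ∀ k x, σ (γ k x) = x)
    (hcl : IsClopen (iter γ 1)) (hsep : GraphSeparation γ) : ∃ v : Fin N → Mat S,
      ∑ k, v k = shift h ∧ ∀ k, v k ∈ B h 1 ∧ IsQuasiMonomial (v k) := by
  classical
  have hrange := isClopen_range hσ hcl hsep
  let p : Fin N → C(X, ℂ) := fun k => extendZero (hrange k) 1 continuousOn_const
  have hp : ∀ k j y, p k (γ j y) = if j = k then 1 else 0 := by
    intro k j y
    change (range (γ k)).indicator 1 (γ j y) = _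
    split_ifs with hjk
    · subst hjk
      rw [indicator_of_mem (mem_range_self y)]
      rfl
    · rw [indicator_of_notMem]
      rintro ⟨z, hz⟩
      have := congrArg σ hz
      rw [hσ, hσ] at this
      subst this
      exact hsep j k hjk _ hz.symm
  have hv : ∀ k y, (rhoA S (p k) * shift h) (e y) = e (h.res k y) := by
    intro k y
    rw [mul_apply_eq_comp, shift_e, map_sum, Finset.sum_eq_single k]
    · rw [rhoA_e, coe_res, hp, if_pos rfl, one_smul]
    · intro j _ hj
      rw [rhoA_e, coe_res, hp, if_neg hj, zero_smul]
    · simp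
  have hentry : ∀ k x y, entry (rhoA S (p k) * shift h) x y ≠ 0 → x = h.res k y := by
    intro k x y hxy
    rw [entry, hv, inner_e_e] at hxy
    by_contra hne
    exact hxy (if_neg hne)
  refine ⟨fun k => rhoA S (p k) * shift h, ?_, fun k => ⟨?_, ?_, ?_⟩⟩
  · refine ext_e fun y => ?_
    rw [_root_.sum_apply, shift_e]
    exact Finset.sum_congr rfl fun k _ => hv k y
  · have := mono_mem_B h hσ (p k) 1 (m := 1) (n := 0) (k := 1) (by simp)
    simpa [mono, rhoA_one] using this
  · intro x y z hy hz
    exact h.res_injective k ((hentry k x y hy).symm.trans (hentry k x z hz))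
  · intro x y z hx hy
    exact (hentry k x z hx).trans (hentry k y z hy).symm

lemma conj_mem_D (h : IsAdmissible γ S) (hσ : ∀ k x, σ (γ k x) = x)
    (hc : ContinuousOn σ (ifsImage γ univ)) (hcl : IsClopen (iter γ 1)) {k l : ℤ} {b α : Mat S}
    (hb : b ∈ B h k) (hbq : IsQuasiMonomial b) (hα : α ∈ D h l) :
    b * α * star b ∈ D h (k + l + -k) ∧ star b * α * b ∈ D h (-k + l + k) := by
  refine ⟨⟨B_mul h hσ hc hcl (B_mul h hσ hc hcl hb hα.1) (B_star h hσ hb),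
    hbq.conj_isDiagonal hα.2⟩,
    ⟨B_mul h hσ hc hcl (B_mul h hσ hc hcl (B_star h hσ hb) hα.1) hb, ?_⟩⟩
  simpa using hbq.star.conj_isDiagonal hα.2

lemma isQuasiMonomial_of_isDiagonal {S : Type*} {α : Mat S} (hα : IsDiagonal α) :
    IsQuasiMonomial α :=
  ⟨fun x y z hy hz => (hα x y hy).symm.trans (hα x z hz),
    fun x y z hx hy => (hα x z hx).trans (hα y z hy).symm⟩

lemma mem_normalizer_D (h : IsAdmissible γ S) (hσ : ∀ k x, σ (γ k x) = x)
    (hc : ContinuousOn σ (ifsImage γ univ)) (hcl : IsClopen (iter γ 1)) {k : ℤ} {b : Mat S}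
    (hb : b ∈ B h k) (hbq : IsQuasiMonomial b) : b ∈ normalizer (D h 0) (cstarRho h) := by
  refine ⟨B_subset h hσ k hb, fun α hα => ?_, fun α hα => ?_⟩
  · simpa using (conj_mem_D h hσ hc hcl hb hbq hα).1
  · simpa using (conj_mem_D h hσ hc hcl hb hbq hα).2

lemma tens_mem_normalizer_DHat (h : IsAdmissible γ S) (hσ : ∀ k x, σ (γ k x) = x)
    (hc : ContinuousOn σ (ifsImage γ univ)) (hcl : IsClopen (iter γ 1)) {k : ℤ} {b : Mat S}
    (hb : b ∈ B h k) (hbq : IsQuasiMonomial b) :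
    tens b k ∈ normalizer (DHat h) (cstarRhoHat h) := by
  have key : ∀ c d : MatZ S, (∀ l : ℤ, ∀ α ∈ D h l, c * tens α l * d ∈ DHat h) →
      ∀ ξ ∈ DHat h, c * ξ * d ∈ DHat h := by
    intro c d hcd ξ hξ
    have hcont : Continuous fun ξ : MatZ S => c * ξ * d := by fun_prop
    have hclosed : IsClosed (DHat h) := Submodule.isClosed_topologicalClosure _
    refine closure_minimal (t := (fun ξ => c * ξ * d) ⁻¹' DHat h) ?_ (hclosed.preimage hcont) hξ
    intro x hx
    change c * x * d ∈ Submodule.topologicalClosure _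
    induction hx using Submodule.span_induction with
    | mem x hx =>
      obtain ⟨l, α, hα, rfl⟩ := hx
      exact hcd l α hα
    | zero => simp
    | add x y _ _ h1 h2 => rw [mul_add, add_mul]; exact add_mem h1 h2
    | smul r x _ h => rw [mul_smul_comm, smul_mul_assoc]; exact Submodule.smul_mem _ r h
  refine ⟨tens_mem_cstarRhoHat h hσ hb, key _ _ fun l α hα => ?_, key _ _ fun l α hα => ?_⟩
  · rw [star_tens, tens_mul, tens_mul]
    exact tens_mem_DHat h (conj_mem_D h hσ hc hcl hb hbq hα).1
  · rw [star_tens, tens_mul, tens_mul]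
    exact tens_mem_DHat h (conj_mem_D h hσ hc hcl hb hbq hα).2

lemma isRegular_D_of_graphSeparation (h : IsAdmissible γ S) (hσ : ∀ k x, σ (γ k x) = x)
    (hc : ContinuousOn σ (ifsImage γ univ)) (hcl : IsClopen (iter γ 1))
    (hsep : GraphSeparation γ) : IsRegular (D h 0) (cstarRho h) := by
  obtain ⟨v, hv, hvB⟩ := exists_branches h hσ hcl hsep
  refine Subset.antisymm (cstarGen_normalizer_subset _) ?_
  have hA : ∀ a, rhoA S a ∈ cstarGen (normalizer (D h 0) (cstarRho h)) := fun a =>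
    subset_cstarGen _ (mem_normalizer_D h hσ hc hcl (rhoA_mem_D h hσ a).1
      (isQuasiMonomial_of_isDiagonal (isDiagonal_rhoA a)))
  refine cstarGen_subset (isClosed_cstarGen _) ?_
  rintro _ (⟨a, rfl⟩ | ⟨f, rfl⟩)
  · exact hA a
  · obtain ⟨a, ha⟩ := exists_rhoE_eq h hσ hc hcl f
    rw [ha, ← hv]
    exact mul_mem (hA a) (sum_mem fun k _ =>
      subset_cstarGen _ (mem_normalizer_D h hσ hc hcl (hvB k).1 (hvB k).2))

lemma isRegular_DHat_of_graphSeparation (h : IsAdmissible γ S) (hσ : ∀ k x, σ (γ k x) = x)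
    (hc : ContinuousOn σ (ifsImage γ univ)) (hcl : IsClopen (iter γ 1))
    (hsep : GraphSeparation γ) : IsRegular (DHat h) (cstarRhoHat h) := by
  obtain ⟨v, hv, hvB⟩ := exists_branches h hσ hcl hsep
  refine Subset.antisymm (cstarGen_normalizer_subset _) ?_
  have hA : ∀ a, tens (rhoA S a) 0 ∈ cstarGen (normalizer (DHat h) (cstarRhoHat h)) := fun a =>
    subset_cstarGen _ (tens_mem_normalizer_DHat h hσ hc hcl (rhoA_mem_D h hσ a).1
      (isQuasiMonomial_of_isDiagonal (isDiagonal_rhoA a)))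
  refine cstarGen_subset (isClosed_cstarGen _) ?_
  rintro _ (⟨a, rfl⟩ | ⟨f, rfl⟩)
  · exact hA a
  · obtain ⟨a, ha⟩ := exists_rhoE_eq h hσ hc hcl f
    have hsum : tens (rhoE h f) 1 = tens (rhoA S a) 0 * ∑ k, tens (v k) 1 := by
      rw [ha, ← hv]
      simp only [← tensL_apply]
      rw [← map_sum, tensL_apply, tensL_apply, tensL_apply, tens_mul, zero_add]
    simp only [hsum]
    exact mul_mem (hA a) (sum_mem fun k _ =>
      subset_cstarGen _ (tens_mem_normalizer_DHat h hσ hc hcl (hvB k).1 (hvB k).2))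

/-! ### Regularity implies graph separation -/

lemma tendsto_zero_of_mem_closure_span {M ι : Type*} [NormedAddCommGroup M] [NormedSpace ℂ M]
    {G : Set M} {φ : ι → M →L[ℂ] ℂ} {K : ℝ} (hφ : ∀ i b, ‖φ i b‖ ≤ K * ‖b‖) {l : Filter ι}
    (hG : ∀ g ∈ G, Filter.Tendsto (fun i => φ i g) l (𝓝 0)) {b : M}
    (hb : b ∈ closure (Submodule.span ℂ G : Set M)) :
    Filter.Tendsto (fun i => φ i b) l (𝓝 0) := by
  have hspan : ∀ c ∈ Submodule.span ℂ G, Filter.Tendsto (fun i => φ i c) l (𝓝 0) := by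
    intro c hc
    induction hc using Submodule.span_induction with
    | mem x hx => exact hG x hx
    | zero => simpa using tendsto_const_nhds
    | add x y _ _ h1 h2 => simpa using h1.add h2
    | smul r x _ h => simpa using h.const_mul r
  rw [Metric.tendsto_nhds]
  intro ε hε
  obtain ⟨c, hc, hbc⟩ := Metric.mem_closure_iff.mp hb (ε / (2 * (|K| + 1))) (by positivity)
  filter_upwards [Metric.tendsto_nhds.mp (hspan c hc) (ε / 2) (by positivity)] with i hi
  rw [dist_zero_right] at hi ⊢
  have h1 : ‖φ i (b - c)‖ ≤ ε / 2 := by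
    refine (hφ i _).trans ?_
    rw [dist_eq_norm] at hbc
    calc K * ‖b - c‖ ≤ (|K| + 1) * (ε / (2 * (|K| + 1))) :=
          mul_le_mul (by linarith [le_abs_self K]) hbc.le (norm_nonneg _) (by positivity)
      _ = ε / 2 := by field_simp
  calc ‖φ i b‖ = ‖φ i (b - c) + φ i c‖ := by rw [← map_add, sub_add_cancel]
    _ ≤ ‖φ i (b - c)‖ + ‖φ i c‖ := norm_add_le _ _
    _ < ε := by linarith

/-- The filter of aperiodic points converging to `x`. -/
def aperiodicNhds (γ : Fin N → C(X, X)) (σ : X → X) (S : Set X) (x : X) :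
    Filter (aperiodic γ σ S) := Filter.comap Subtype.val (𝓝 x)

/-- An aperiodic point, as an element of the index set of the matrices. -/
def toS (p : aperiodic γ σ S) : S := ⟨p, p.2.1⟩

lemma meets_res_iff (hσ : ∀ k x, σ (γ k x) = x) (j k : Fin N)
    (p : aperiodic γ σ S) (m n : ℕ) : Meets γ σ m n (γ j p) p ↔ Meets γ σ m n (γ k p) p := by
  -- The case `m = 0` is excluded by aperiodicity, and for `m > 0` the ancestors of `γ_i(p)` are
  -- those of `p`.
  have key : ∀ i, Meets γ σ m n (γ i p) p ↔ ∃ m', m = m' + 1 ∧ Meets γ σ m' n p p := by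
    intro i
    cases m with
    | zero =>
      refine ⟨fun hm => ?_, fun ⟨m', hm', _⟩ => absurd hm' (by omega)⟩
      have := hm.degree_unique hσ p.2 (meets_wd hσ [i] (p : X))
      simp at this
      omega
    | succ m =>
      simp only [Meets, apply_mem_iter_succ hσ, Function.iterate_succ_apply, hσ]
      constructor
      · exact fun hm => ⟨m, rfl, hm⟩
      · rintro ⟨m', hm', hm⟩
        obtain rfl : m = m' := by omega
        exact hm
  rw [key j, key k]

/-- At a branching point `γ_j(x) = γ_k(x)`, the rows `γ_j(p)` and `γ_k(p)` of a monomial become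
indistinguishable in the column `p`, as `p → x`. -/
lemma tendsto_entry_mono_sub (h : IsAdmissible γ S) (hσ : ∀ k x, σ (γ k x) = x) {j k : Fin N}
    {x : X} (hx : γ j x = γ k x) (a b : C(X, ℂ)) (m n : ℕ) :
    Filter.Tendsto (fun p => entry (mono h a m n b) (h.res j (toS p)) (toS p) -
      entry (mono h a m n b) (h.res k (toS p)) (toS p)) (aperiodicNhds γ σ S x) (𝓝 0) := by
  classical
  have hlim : Filter.Tendsto (fun p : aperiodic γ σ S => ‖a (γ j p) - a (γ k p)‖ * ‖b‖)
      (aperiodicNhds γ σ S x) (𝓝 0) := by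
    have hcont : Continuous fun y => ‖a (γ j y) - a (γ k y)‖ * ‖b‖ := by fun_prop
    have := (hcont.tendsto x).comp (Filter.tendsto_comap (f := (Subtype.val : aperiodic γ σ S → X)))
    rwa [hx, sub_self, norm_zero, zero_mul] at this
  refine squeeze_zero_norm (fun p => ?_) hlim
  rw [entry_mono h hσ, entry_mono h hσ]
  have hiff : Meets γ σ m n (h.res j (toS p) : X) (toS p) ↔
      Meets γ σ m n (h.res k (toS p) : X) (toS p) := meets_res_iff hσ j k p m n
  by_cases hm : Meets γ σ m n (h.res j (toS p) : X) (toS p)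
  · rw [if_pos hm, if_pos (hiff.mp hm), ← sub_mul, norm_mul]
    exact mul_le_mul_of_nonneg_left (b.norm_coe_le_norm _) (norm_nonneg _)
  · rw [if_neg hm, if_neg fun hm' => hm (hiff.mpr hm'), sub_self, norm_zero]
    positivity

lemma aperiodicNhds_neBot (hdense : Dense (aperiodic γ σ S)) (x : X) :
    (aperiodicNhds γ σ S x).NeBot :=
  mem_closure_iff_comap_neBot.mp (hdense x)

lemma entry_shift_res (h : IsAdmissible γ S) (k : Fin N) (y : S) :
    entry (shift h) (h.res k y) y = 1 := by
  classical
  rw [entry, shift_e, inner_sum, Finset.sum_eq_single k]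
  · rw [inner_e_e, if_pos rfl]
  · intro i _ hi
    rw [inner_e_e, if_neg fun heq => hi ((res_inj h).mp heq).1.symm]
  · simp

/-- If one of two entries vanishes and their difference tends to zero, then so does the first. -/
lemma tendsto_zero_of_sub {ι : Type*} {l : Filter ι} {f g : ι → ℂ}
    (hfg : Filter.Tendsto (fun i => f i - g i) l (𝓝 0)) (h0 : ∀ i, f i * star (g i) = 0) :
    Filter.Tendsto f l (𝓝 0) := by
  refine squeeze_zero_norm (fun i => ?_) (tendsto_zero_iff_norm_tendsto_zero.mp hfg)
  rcases mul_eq_zero.mp (h0 i) with hi | hi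
  · rw [hi, norm_zero]
    exact norm_nonneg _
  · rw [star_eq_zero.mp hi, sub_zero]

lemma graphSeparation_of_isRegular_D (h : IsAdmissible γ S) (hσ : ∀ k x, σ (γ k x) = x)
    (hc : ContinuousOn σ (ifsImage γ univ)) (hcl : IsClopen (iter γ 1))
    (hdense : Dense (aperiodic γ σ S)) (hreg : IsRegular (D h 0) (cstarRho h)) :
    GraphSeparation γ := by
  intro j k hjk x hx
  have := aperiodicNhds_neBot hdense x
  let φ : aperiodic γ σ S → Mat S →L[ℂ] ℂ := fun p => entryL (h.res j (toS p)) (toS p)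
  let ψ : aperiodic γ σ S → Mat S →L[ℂ] ℂ := fun p => entryL (h.res k (toS p)) (toS p)
  have hφ : ∀ p b, ‖φ p b‖ ≤ 1 * ‖b‖ := fun p b => by rw [one_mul]; exact norm_entry_le _ _ b
  have hψ : ∀ p b, ‖ψ p b‖ ≤ 1 * ‖b‖ := fun p b => by rw [one_mul]; exact norm_entry_le _ _ b
  have hdiff : ∀ b ∈ cstarRho h,
      Filter.Tendsto (fun p => φ p b - ψ p b) (aperiodicNhds γ σ S x) (𝓝 0) := by
    intro b hb
    refine tendsto_zero_of_mem_closure_span (φ := fun p => φ p - ψ p) (K := 2)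
      (fun p b => ?_) ?_ (cstarRho_subset h hσ hc hcl hb)
    · refine (norm_sub_le (φ p b) (ψ p b)).trans ((add_le_add (hφ p b) (hψ p b)).trans_eq ?_)
      ring
    · rintro _ ⟨a, m, n, b, rfl⟩
      exact tendsto_entry_mono_sub h hσ hx a b m n
  have hN : ∀ b ∈ normalizer (D h 0) (cstarRho h),
      Filter.Tendsto (fun p => φ p b) (aperiodicNhds γ σ S x) (𝓝 0) := by
    intro b hb
    refine tendsto_zero_of_sub (hdiff b hb.1) fun p => ?_
    by_contra hne0
    have hne := mul_ne_zero_iff.mp hne0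
    rw [star_ne_zero] at hne
    exact hjk ((res_inj h).mp
      ((isQuasiMonomial_of_mem_normalizer h hσ hb).2 _ _ _ hne.1 hne.2)).1
  have hT : shift h ∈ (cstarGen (normalizer (D h 0) (cstarRho h)) : Set (Mat S)) := by
    rw [show (cstarGen (normalizer (D h 0) (cstarRho h)) : Set (Mat S)) = _ from hreg]
    exact rhoE_mem h 1
  have hlim := tendsto_zero_of_mem_closure_span hφ hN
    (cstarGen_normalizer_subset_closure_span _ hT)
  have h1 : ∀ p, φ p (shift h) = 1 := fun p => entry_shift_res h j (toS p)
  simp only [h1] at hlim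
  exact one_ne_zero (tendsto_nhds_unique tendsto_const_nhds hlim)

lemma graphSeparation_of_isRegular_DHat (h : IsAdmissible γ S) (hσ : ∀ k x, σ (γ k x) = x)
    (hc : ContinuousOn σ (ifsImage γ univ)) (hcl : IsClopen (iter γ 1))
    (hdense : Dense (aperiodic γ σ S)) (hreg : IsRegular (DHat h) (cstarRhoHat h)) :
    GraphSeparation γ := by
  intro j k hjk x hx
  have := aperiodicNhds_neBot hdense x
  let φ : aperiodic γ σ S → MatZ S →L[ℂ] ℂ := fun p => entryZ (h.res j (toS p)) 1 (toS p) 0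
  let ψ : aperiodic γ σ S → MatZ S →L[ℂ] ℂ := fun p => entryZ (h.res k (toS p)) 1 (toS p) 0
  have hφ : ∀ p b, ‖φ p b‖ ≤ 1 * ‖b‖ := fun p b => by rw [one_mul]; exact norm_entryZ_le _ _ _ _ b
  have hψ : ∀ p b, ‖ψ p b‖ ≤ 1 * ‖b‖ := fun p b => by rw [one_mul]; exact norm_entryZ_le _ _ _ _ b
  have hdiff : ∀ b ∈ cstarRhoHat h,
      Filter.Tendsto (fun p => φ p b - ψ p b) (aperiodicNhds γ σ S x) (𝓝 0) := by
    intro b hb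
    refine tendsto_zero_of_mem_closure_span (φ := fun p => φ p - ψ p) (K := 2)
      (fun p b => ?_) ?_ (cstarRhoHat_subset h hσ hc hcl hb)
    · refine (norm_sub_le (φ p b) (ψ p b)).trans ((add_le_add (hφ p b) (hψ p b)).trans_eq ?_)
      ring
    · rintro _ ⟨a, m, n, b, rfl⟩
      have hent : ∀ p, (φ p - ψ p) (tens (mono h a m n b) (m - n)) =
          entryZ (h.res j (toS p)) 1 (toS p) 0 (tens (mono h a m n b) (m - n)) -
          entryZ (h.res k (toS p)) 1 (toS p) 0 (tens (mono h a m n b) (m - n)) := fun p => rfl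
      simp only [hent, entryZ_tens]
      by_cases hmn : (1 : ℤ) = m - n + 0
      · simp only [if_pos hmn]
        exact tendsto_entry_mono_sub h hσ hx a b m n
      · simp only [if_neg hmn, sub_self]
        exact tendsto_const_nhds
  -- In the column of an aperiodic point, only one power of the shift contributes to each row.
  have hlevel : ∀ b ∈ cstarRhoHat h, ∀ (p : aperiodic γ σ S) (l : ℤ), l ≠ 0 →
      entryZ (h.res j (toS p)) 1 (toS p) l b = 0 := by
    intro b hb p l hl
    refine closure_minimal (t := {b | entryZ (h.res j (toS p)) 1 (toS p) l b = 0}) ?_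
      (isClosed_eq (entryZ _ _ _ _).continuous continuous_const) (cstarRhoHat_subset h hσ hc hcl hb)
    change _ ≤ LinearMap.ker (entryZ (h.res j (toS p)) 1 (toS p) l : MatZ S →ₗ[ℂ] ℂ)
    refine Submodule.span_le.mpr ?_
    rintro _ ⟨a, m, n, b, rfl⟩
    change entryZ (h.res j (toS p)) 1 (toS p) l (tens (mono h a m n b) (m - n)) = 0
    rw [entryZ_tens]
    split_ifs with hlev
    · rw [entry_mono h hσ, if_neg]
      intro hm
      have h1 : 1 + n = m + 0 := (meets_wd hσ [j] (p : X)).degree_unique hσ p.2 hm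
      omega
    · rfl
  have hN : ∀ b ∈ normalizer (DHat h) (cstarRhoHat h),
      Filter.Tendsto (fun p => φ p b) (aperiodicNhds γ σ S x) (𝓝 0) := by
    intro b hb
    refine tendsto_zero_of_sub (hdiff b hb.1) fun p => ?_
    set y := h.res j (toS p) with hy
    set z := h.res k (toS p) with hz
    have hyz : y ≠ z := fun heq => hjk ((res_inj h).mp heq).1
    obtain ⟨a, h1, h2, h3⟩ := exists_bumps (toS p)
    have hlim := tendsto_inner_tens_rhoA (toS p) h1 h2 h3 (star b (eZ y 1)) (star b (eZ z 1))
    have h0 : ∀ F, inner ℂ (star b (eZ y 1)) (tens (rhoA S (a F)) 0 (star b (eZ z 1))) = 0 := by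
      intro F
      have h4 := entryZ_eq_zero_of_mem_DHat h
        (hb.2.1 _ (tens_mem_DHat h (rhoA_mem_D h hσ (a F)))) hyz 1 1
      rw [ContinuousLinearMap.star_eq_adjoint, ContinuousLinearMap.adjoint_inner_left]
      exact h4
    simp only [h0] at hlim
    have h5 := tendsto_nhds_unique hlim tendsto_const_nhds
    rw [tsum_eq_single 0] at h5
    · rwa [← entryZ_apply, ← entryZ_apply, entryZ_star, entryZ_star, star_star] at h5
    · intro l hl
      rw [← entryZ_apply, entryZ_star, star_star, hlevel b hb.1 p l hl, zero_mul]
  have hT : tens (shift h) 1 ∈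
      (cstarGen (normalizer (DHat h) (cstarRhoHat h)) : Set (MatZ S)) := by
    rw [show (cstarGen (normalizer (DHat h) (cstarRhoHat h)) : Set (MatZ S)) = _ from hreg]
    exact subset_cstarGen _ (Or.inr ⟨1, rfl⟩)
  have hlim := tendsto_zero_of_mem_closure_span hφ hN
    (cstarGen_normalizer_subset_closure_span _ hT)
  have h1 : ∀ p, φ p (tens (shift h) 1) = 1 := fun p => by
    change entryZ _ _ _ _ _ = _
    rw [entryZ_tens, if_pos (by norm_num), entry_shift_res]
  simp only [h1] at hlim
  exact one_ne_zero (tendsto_nhds_unique tendsto_const_nhds hlim)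

end regularity

end KW

theorem theorem5p9p8 {X : Type*} [TopologicalSpace X] [CompactSpace X] [T2Space X]
    [FirstCountableTopology X] {N : ℕ} (γ : Fin N → C(X, X)) (S U : Set X)
    (hS : KW.IsAdmissible γ S)
    (hemb : ∀ k, IsEmbedding (γ k))
    (hUopen : IsOpen U) (hUdense : Dense U)
    (hUimage : ∀ k, IsOpen (γ k '' U))
    (hUdisj : Pairwise fun j k => Disjoint (γ j '' U) (γ k '' U))
    (hUsub : ∀ k, γ k '' U ⊆ U)
    (hSU : S ⊆ U) (hScomeager : S ∈ residual X)
    (hfree : KW.EssentiallyFree γ)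
    (hclopen : ∀ n : ℕ, IsClopen ((KW.ifsImage γ)^[n] univ))
    (hσ : ∃ σ : X → X, ContinuousOn σ (KW.ifsImage γ univ) ∧ ∀ k x, σ (γ k x) = x) :
    KW.IsCStarSubalgebra (KW.D hS 0) (KW.cstarRho hS) ∧
    KW.IsCStarSubalgebra (KW.DHat hS) (KW.cstarRhoHat hS) ∧
    List.TFAE [KW.GraphSeparation γ,
      KW.IsRegular (KW.D hS 0) (KW.cstarRho hS),
      KW.IsRegular (KW.DHat hS) (KW.cstarRhoHat hS)] ∧
    KW.normalizer (KW.D hS 0) (KW.cstarRho hS) =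
      KW.cstarRho hS ∩ {α | KW.IsQuasiMonomial α} := by
  obtain ⟨σ, hc, hσx⟩ := hσ
  have hcl : IsClopen (KW.iter γ 1) := hclopen 1
  have hdense := KW.dense_aperiodic hS hσx hc hclopen hScomeager hfree
  refine ⟨KW.isCStarSubalgebra_D hS hσx hc hcl, KW.isCStarSubalgebra_DHat hS hσx hc hcl, ?_,
    KW.normalizer_D_eq hS hσx hc hcl hdense⟩
  tfae_have 1 → 2 := KW.isRegular_D_of_graphSeparation hS hσx hc hcl
  tfae_have 1 → 3 := KW.isRegular_DHat_of_graphSeparation hS hσx hc hcl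
  tfae_have 2 → 1 := KW.graphSeparation_of_isRegular_D hS hσx hc hcl hdense
  tfae_have 3 → 1 := KW.graphSeparation_of_isRegular_DHat hS hσx hc hcl hdense
  tfae_finish
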